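/- **Setting.** For $A\in\mathbb R^{m\times n}$, $b\in\mathbb R^m$, $c\in\mathbb R^n$, $n\ge 1$, and symmetric positive semi-definite $Q\in\mathbb R^{n\times n}$ consider the pair (P) $\min_x\ c^Tx+\tfrac12x^TQx$ s.t. $Ax=b,\ x\ge0$; (D) $\max_{x,y,z}\ b^Ty-\tfrac12x^TQx$ s.t. $-Qx+A^Ty+z=c,\ z\ge0$. Let $\|(r,s)\|_{\mathcal A}=\min\{\|(x,z)\|_2: Ax=r,\ -Qx+A^Ty+z=s\}$. **Algorithm IP-PMM.** Parameters: $0<\sigma_{\min}\le\sigma_{\max}\le\frac12$, $C_N>0$, $\gamma_{\mathcal A},\gamma_\mu\in(0,1)$, $\rho>0$, and a tolerance $\mathrm{tol}$. Start: $x_0=z_0=\rho e$, $y_0$ with $\|y_0\|_\infty\le C_y$, $\zeta_0=x_0$, $\lambda_0=y_0$, $\mu_0=x_0^Tz_0/n$, $\bar b=Ax_0-b$, $\bar c=-Qx_0+A^Ty_0+z_0-c$. For $\mu,\zeta,\lambda$ let $\mathcal N_\mu(\zeta,\lambda)$ be the set of $(x,y,z)$ with $x,z>0$, $x^iz^i\ge\gamma_\mu\mu$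 for all $i$, for which there are $\tilde b,\tilde c$ with $\|(\tilde b,\tilde c)\|_2\le C_N$, $\|(\tilde b,\tilde c)\|_{\mathcal A}\le\gamma_{\mathcal A}\rho$ and $$Ax+\mu(y-\lambda)=b+\tfrac{\mu}{\mu_0}(\bar b+\tilde b),\qquad -Qx+A^Ty+z-\mu(x-\zeta)=c+\tfrac{\mu}{\mu_0}(\bar c+\tilde c).$$ Iteration $k$, with $\mu_k=x_k^Tz_k/n$: stop if $\|Ax_k-b\|_2$, $\|c+Qx_k-A^Ty_k-z_k\|_2$ and $\mu_k$ are all $<\mathrm{tol}$. Otherwise choose $\sigma_k\in[\sigma_{\min},\sigma_{\max}]$ and solve for $(\Delta x,\Delta y,\Delta z)$ the Newton system $$-(Q+\mu_kI)\Delta x+A^T\Delta y+\Delta z=c+\tfrac{\sigma_k\mu_k}{\mu_0}\bar c+Qx_k-A^Ty_k-z_k+\sigma_k\mu_k(x_k-\zeta_k),$$ $$A\Delta x+\mu_k\Delta y=b+\tfrac{\sigma_k\mu_k}{\mu_0}\bar b-Ax_k-\sigma_k\mu_k(y_k-\lambda_k),\qquad z_k^i\Delta x^i+x_k^i\Delta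 z^i=-x_k^iz_k^i+\sigma_k\mu_k\ \ \forall i.$$ With $w_k(\alpha)=(x_k,y_k,z_k)+\alpha(\Delta x,\Delta y,\Delta z)$ and $\mu_k(\alpha)=(x_k+\alpha\Delta x)^T(z_k+\alpha\Delta z)/n$, call $\alpha\in(0,1]$ acceptable if $\mu_k(\alpha)\le(1-0.01\alpha)\mu_k$ and $w_k(\alpha)\in\mathcal N_{\mu_k(\alpha)}(\zeta_k,\lambda_k)$. Let $\alpha_k$ be the largest acceptable $\alpha$, put $(x_{k+1},y_{k+1},z_{k+1})=w_k(\alpha_k)$, $r_p=Ax_{k+1}-(b+\frac{\mu_{k+1}}{\mu_0}\bar b)$, $r_d=-Qx_{k+1}+A^Ty_{k+1}+z_{k+1}-(c+\frac{\mu_{k+1}}{\mu_0}\bar c)$. If $\|(r_p,r_d)\|_2\le C_N\frac{\mu_{k+1}}{\mu_0}$ and $\|(r_p,r_d)\|_{\mathcal A}\le\gamma_{\mathcal A}\rho\frac{\mu_{k+1}}{\mu_0}$, set $(\zeta_{k+1},\lambda_{k+1})=(x_{k+1},y_{k+1})$; otherwise $(\zeta_{k+1},\lambda_{k+1})=(\zeta_k,\lambda_k)$.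 **Assumption 1** (constant $C^*\ge0$). There is an optimal solution $(x^*,y^*,z^*)$ of the pair (P)–(D) (i.e. $x^*$ solves (P) and $(x^*,y^*,z^*)$ solves (D)) with $\|x^*\|_\infty,\|y^*\|_\infty,\|z^*\|_\infty\le C^*$. **Assumption 2** (constants $C_A^1,C_A^2,C_Q,C_r>0$). $\operatorname{rank}A=m$, all $m$ singular values of $A$ lie in $[C_A^1,C_A^2]$, the eigenvalues of $Q$ are at most $C_Q$, and $\|(c,b)\|_\infty\le C_r$. **Theorem.** Fix the parameters $\sigma_{\min},\sigma_{\max},C_N,\gamma_{\mathcal A},\gamma_\mu,\rho$, the constants $C_y,C^*,C_A^1,C_A^2,C_Q,C_r$, constants $C,\omega>0$, and $\bar\epsilon\in(0,1)$. There is a constant $M$, depending on these only (not on $n$, $m$, the data $A,Q,b,c,y_0$, or $\epsilon$), such that for all $m$, $n\ge1$, all problems satisfying Assumptions 1 and 2 with these constants, all $y_0$ with $\|y_0\|_\infty\le C_y$, and all $\epsilon\in(0,\bar\epsilon]$ with $\mu_0\le C/\epsilon^\omega$, there is an index $$K\le M\,n^4\,\bigl|\log(1/\epsilon)\bigr|$$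 such that, for every tolerance and every execution of IP-PMM, all iterates generated satisfy $\mu_k\le\epsilon$ for all $k\ge K$. Moreover, at every iterate reached and for every $\sigma_k\in[\sigma_{\min},\sigma_{\max}]$, the Newton system has exactly one solution and acceptable step-lengths exist. -/

import Mathlib

open scoped Matrix

noncomputable section

namespace IPPMM

/-- The Euclidean norm of a vector of `ℝᵏ`. -/
def l2 {k : ℕ} (u : Fin k → ℝ) : ℝ := √(u ⬝ᵥ u)

/-- The Euclidean norm of the pair `(u, v)`, seen as one stacked vector. -/
def pairNorm {k l : ℕ} (u : Fin k → ℝ) (v : Fin l → ℝ) : ℝ := √(u ⬝ᵥ u + v ⬝ᵥ v)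

/-- Data of the convex quadratic programming pair
(P) `min cᵀx + ½ xᵀQx` subject to `Ax = b`, `x ≥ 0`;
(D) `max bᵀy - ½ xᵀQx` subject to `-Qx + Aᵀy + z = c`, `z ≥ 0`. -/
structure Problem (m n : ℕ) where
  A : Matrix (Fin m) (Fin n) ℝ
  Q : Matrix (Fin n) (Fin n) ℝ
  b : Fin m → ℝ
  c : Fin n → ℝ
  /-- symmetric and positive semi-definite -/
  psd : Q.PosSemidef

/-- A primal-dual triple `(x, y, z)`. -/
structure Triple (m n : ℕ) where
  x : Fin n → ℝ
  y : Fin m → ℝ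
  z : Fin n → ℝ

/-- The complementarity average `μ = xᵀz / n`. -/
def Triple.mu {m n : ℕ} (w : Triple m n) : ℝ := w.x ⬝ᵥ w.z / n

/-- `w + α d`. -/
def Triple.move {m n : ℕ} (w : Triple m n) (α : ℝ) (d : Triple m n) : Triple m n where
  x := w.x + α • d.x
  y := w.y + α • d.y
  z := w.z + α • d.z

namespace Problem

variable {m n : ℕ} (P : Problem m n)

/-- The left-hand side `-Qx + Aᵀy + z` of the dual constraint. -/
def dualMap (w : Triple m n) : Fin n → ℝ := -(P.Q *ᵥ w.x) + P.Aᵀ *ᵥ w.y + w.z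

def primalFeasible (x : Fin n → ℝ) : Prop := P.A *ᵥ x = P.b ∧ ∀ i, 0 ≤ x i

def primalObj (x : Fin n → ℝ) : ℝ := P.c ⬝ᵥ x + 1 / 2 * (x ⬝ᵥ P.Q *ᵥ x)

def dualFeasible (w : Triple m n) : Prop := P.dualMap w = P.c ∧ ∀ i, 0 ≤ w.z i

def dualObj (w : Triple m n) : ℝ := P.b ⬝ᵥ w.y - 1 / 2 * (w.x ⬝ᵥ P.Q *ᵥ w.x)

/-- `(x, y, z)` is optimal for the pair: `x` solves (P) and `(x, y, z)` solves (D). -/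
def IsOptimal (w : Triple m n) : Prop :=
  (P.primalFeasible w.x ∧ ∀ x', P.primalFeasible x' → P.primalObj w.x ≤ P.primalObj x') ∧
  (P.dualFeasible w ∧ ∀ w', P.dualFeasible w' → P.dualObj w' ≤ P.dualObj w)

/-- There is an optimal triple bounded by `C` in the maximum norm (the norm of `Fin k → ℝ`). -/
def BoundedOptimum (C : ℝ) : Prop :=
  ∃ w : Triple m n, P.IsOptimal w ∧ ‖w.x‖ ≤ C ∧ ‖w.y‖ ≤ C ∧ ‖w.z‖ ≤ C

/-- Full row rank; all `m` singular values of the full-row-rank matrix `A` lie in `[CA₁, CA₂]`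
(Mathlib lists the singular values in decreasing order, padded by zeros, so they are those of index
`i < m`); the eigenvalues of `Q` are at most `CQ`; the entries of `c` and `b` are at most `Cr` in
absolute value. -/
def BoundedData (CA₁ CA₂ CQ Cr : ℝ) : Prop :=
  P.A.rank = m ∧
  (∀ i < m, CA₁ ≤ (Matrix.toEuclideanLin P.A).singularValues i) ∧
  (∀ i < m, (Matrix.toEuclideanLin P.A).singularValues i ≤ CA₂) ∧
  (∀ i, P.psd.isHermitian.eigenvalues i ≤ CQ) ∧
  ‖P.c‖ ≤ Cr ∧ ‖P.b‖ ≤ Cr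

/-- The semi-norm
`‖(r, s)‖_𝒜 = min { ‖(x, z)‖₂ : A x = r, -Q x + Aᵀ y + z = s }`. -/
def seminormA (r : Fin m → ℝ) (s : Fin n → ℝ) : ℝ :=
  sInf {v | ∃ w : Triple m n, P.A *ᵥ w.x = r ∧ P.dualMap w = s ∧ v = pairNorm w.x w.z}

end Problem

/-- The parameters of the algorithm. -/
structure Params where
  σmin : ℝ
  σmax : ℝ
  CN : ℝ
  γA : ℝ
  γμ : ℝ
  σmin_pos : 0 < σmin
  σmin_le : σmin ≤ σmax
  σmax_le : σmax ≤ 1 / 2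
  CN_pos : 0 < CN
  γA_pos : 0 < γA
  γA_lt : γA < 1
  γμ_pos : 0 < γμ
  γμ_lt : γμ < 1

/-- The starting triple `(x₀, z₀) = ρ (e, e)`, with a chosen `y₀`. -/
def startTriple {m : ℕ} (n : ℕ) (ρ : ℝ) (y₀ : Fin m → ℝ) : Triple m n where
  x := fun _ => ρ
  y := y₀
  z := fun _ => ρ

/-- A state of the algorithm: the iterate `(x, y, z)` and the proximal estimates `ζ`, `λ`. -/
structure State (m n : ℕ) where
  w : Triple m n
  zeta : Fin n → ℝ
  lam : Fin m → ℝ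

/-- The initial state: `ζ₀ = x₀`, `λ₀ = y₀`. -/
def startState {m : ℕ} (n : ℕ) (ρ : ℝ) (y₀ : Fin m → ℝ) : State m n where
  w := startTriple n ρ y₀
  zeta := fun _ => ρ
  lam := y₀

section Algorithm

variable {m n : ℕ} (par : Params) (P : Problem m n) (ρ : ℝ) (y₀ : Fin m → ℝ)

/-- `μ₀ = x₀ᵀ z₀ / n`. -/
def mu0 : ℝ := (startTriple n ρ y₀).mu

/-- `b̄ = A x₀ - b`. -/
def bbar : Fin m → ℝ := P.A *ᵥ (startTriple n ρ y₀).x - P.b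

/-- `c̄ = -Q x₀ + Aᵀ y₀ + z₀ - c`. -/
def cbar : Fin n → ℝ := P.dualMap (startTriple n ρ y₀) - P.c

/-- The neighbourhood `𝒩_μ(ζ, λ)`. -/
def neighbourhood (μ : ℝ) (zeta : Fin n → ℝ) (lam : Fin m → ℝ) : Set (Triple m n) :=
  {w | (∃ (btil : Fin m → ℝ) (ctil : Fin n → ℝ),
      P.A *ᵥ w.x + μ • (w.y - lam)
        = P.b + (μ / mu0 (n := n) ρ y₀) • (bbar P ρ y₀ + btil) ∧
      P.dualMap w - μ • (w.x - zeta)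
        = P.c + (μ / mu0 (n := n) ρ y₀) • (cbar P ρ y₀ + ctil) ∧
      pairNorm btil ctil ≤ par.CN ∧ P.seminormA btil ctil ≤ par.γA * ρ) ∧
    (∀ i, 0 < w.x i) ∧ (∀ i, 0 < w.z i) ∧ ∀ i, par.γμ * μ ≤ w.x i * w.z i}

/-- `d = (Δx, Δy, Δz)` solves the Newton system at the state `s` with centering parameter `σ`. -/
def IsNewton (s : State m n) (σ : ℝ) (d : Triple m n) : Prop :=
  P.dualMap d - s.w.mu • d.x
    = -(-(P.c + (σ * s.w.mu / mu0 (n := n) ρ y₀) • cbar P ρ y₀) + P.dualMap s.w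
        - (σ * s.w.mu) • (s.w.x - s.zeta)) ∧
  P.A *ᵥ d.x + s.w.mu • d.y
    = -(P.A *ᵥ s.w.x + (σ * s.w.mu) • (s.w.y - s.lam)
        - (P.b + (σ * s.w.mu / mu0 (n := n) ρ y₀) • bbar P ρ y₀)) ∧
  ∀ i, s.w.z i * d.x i + s.w.x i * d.z i = -(s.w.x i * s.w.z i - σ * s.w.mu)

/-- The step-lengths `α ∈ (0, 1]` that are acceptable at the state `s` along the direction `d`. -/
def acceptable (s : State m n) (d : Triple m n) : Set ℝ :=
  {α | 0 < α ∧ α ≤ 1 ∧ (s.w.move α d).mu ≤ (1 - 0.01 * α) * s.w.mu ∧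
    s.w.move α d ∈ neighbourhood par P ρ y₀ (s.w.move α d).mu s.zeta s.lam}

/-- The test that decides whether the proximal estimates are replaced by the new iterate `w`: the
unregularized residuals `r_p = Ax - (b + (μ/μ₀) b̄)` and `r_d = -Qx + Aᵀy + z - (c + (μ/μ₀) c̄)`
satisfy the two bounds of the neighbourhood. -/
def updateTest (w : Triple m n) : Prop :=
  let rp := P.A *ᵥ w.x - (P.b + (w.mu / mu0 (n := n) ρ y₀) • bbar P ρ y₀)
  let rd := P.dualMap w - (P.c + (w.mu / mu0 (n := n) ρ y₀) • cbar P ρ y₀)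
  pairNorm rp rd ≤ par.CN * (w.mu / mu0 (n := n) ρ y₀) ∧
    P.seminormA rp rd ≤ par.γA * ρ * (w.mu / mu0 (n := n) ρ y₀)

/-- One iteration of IP-PMM takes the state `s` to the state `s'`. -/
def Step (s s' : State m n) : Prop :=
  ∃ (σ : ℝ) (d : Triple m n) (α : ℝ),
    par.σmin ≤ σ ∧ σ ≤ par.σmax ∧
    IsNewton P ρ y₀ s σ d ∧
    IsGreatest (acceptable par P ρ y₀ s d) α ∧
    s'.w = s.w.move α d ∧
    (updateTest par P ρ y₀ s'.w → s'.zeta = s'.w.x ∧ s'.lam = s'.w.y) ∧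
    (¬ updateTest par P ρ y₀ s'.w → s'.zeta = s.zeta ∧ s'.lam = s.lam)

/-- The stopping criterion. -/
def Stopped (tol : ℝ) (s : State m n) : Prop :=
  l2 (P.A *ᵥ s.w.x - P.b) < tol ∧ l2 (P.c - P.dualMap s.w) < tol ∧ s.w.mu < tol

/-- `s 0, …, s N` are the first `N + 1` states of an execution of IP-PMM with tolerance `tol`. -/
def IsRun (tol : ℝ) (N : ℕ) (s : ℕ → State m n) : Prop :=
  s 0 = startState n ρ y₀ ∧
    ∀ k < N, ¬ Stopped P tol (s k) ∧ Step par P ρ y₀ (s k) (s (k + 1))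

end Algorithm

end IPPMM

end

/-! Write θ = μ/μ₀, where μ₀ = ρ². Everything reduces to one fact, `exists_uniform_step`: a step
κ/n⁴, with κ depending on the fixed constants only, is acceptable at every state that is reached.
Since the largest acceptable step is taken, each iteration multiplies μ by at most 1 - 0.01κ/n⁴, and
the logarithmic iteration count follows.

Along a Newton direction each condition of the neighbourhood changes linearly in α up to an α²
error. Centering with σ ≥ σmin leaves room of order ασμ in each of them, so small α works once |Δxᵢ
Δzᵢ| = O(n⁴μ) and ‖(Δx, Δy)‖² = O(n⁴) (`direction_bound`, `exists_acceptable`).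

These bounds rest on monotonicity. A solution of the homogeneous regularized equations satisfies Δxᵀ
Δz ≥ μ(‖Δx‖² + ‖Δy‖²), and a residual that carries a factor μ only adds terms with the same factor
(`regularized_dot`), so μ cancels. The points of comparison come from the optimum v, which is
complementary by the KKT conditions. An admissible perturbation has semi-norm at most γ_A ρ < ρ, so
it is realised by a shift of the start that leaves a positive triple e; the perturbed right-hand
sides are then exactly those of (1-θ)v + θe (`exists_interior`), a point with xᵀz = O(θn).

The estimates are chained. The proximal estimates come from iterates satisfying unregularized
equations, which bounds them (`unregularized_bound`). This bounds an auxiliary solution u of the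
regularized equations (`proximal_bound`). Comparison with u gives θ(∑x + ∑z) = O(n²μ)
(`iterate_bound`). Squaring a complementarity residual of total size O(n²μ) and dividing by xᵢzᵢ ≥
γ_μ μ produces n⁴μ. -/

noncomputable section

namespace IPPMM

/-! ### Elementary Euclidean estimates. -/

section DotProduct

variable {ι κ : Type*} [Fintype ι] [Fintype κ]

lemma dot_self_nonneg (u : ι → ℝ) : 0 ≤ u ⬝ᵥ u :=
  Finset.sum_nonneg fun i _ => mul_self_nonneg (u i)

lemma two_dot_le (u v : ι → ℝ) : 2 * (u ⬝ᵥ v) ≤ u ⬝ᵥ u + v ⬝ᵥ v := by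
  simp only [dotProduct, Finset.mul_sum, ← Finset.sum_add_distrib]
  exact Finset.sum_le_sum fun i _ => by nlinarith [sq_nonneg (u i - v i)]

lemma neg_two_dot_le (u v : ι → ℝ) : -(2 * (u ⬝ᵥ v)) ≤ u ⬝ᵥ u + v ⬝ᵥ v := by
  simpa using two_dot_le (-u) v

lemma add_dot_self_le (u v : ι → ℝ) :
    (u + v) ⬝ᵥ (u + v) ≤ 2 * (u ⬝ᵥ u) + 2 * (v ⬝ᵥ v) := by
  have := two_dot_le u v
  simp only [add_dotProduct, dotProduct_add, dotProduct_comm v u]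
  linarith

lemma sub_dot_self_le (u v : ι → ℝ) :
    (u - v) ⬝ᵥ (u - v) ≤ 2 * (u ⬝ᵥ u) + 2 * (v ⬝ᵥ v) := by
  simpa [sub_eq_add_neg] using add_dot_self_le u (-v)

lemma smul_dot_self (a : ℝ) (u : ι → ℝ) : (a • u) ⬝ᵥ (a • u) = a ^ 2 * (u ⬝ᵥ u) := by
  simp only [smul_dotProduct, dotProduct_smul, smul_eq_mul]; ring

lemma dot_le_of_sq_le {u v : ι → ℝ} {a b : ℝ} (ha : 0 ≤ a) (hb : 0 ≤ b)
    (hu : u ⬝ᵥ u ≤ a ^ 2) (hv : v ⬝ᵥ v ≤ b ^ 2) : |u ⬝ᵥ v| ≤ a * b := by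
  have h : (u ⬝ᵥ v) ^ 2 ≤ (u ⬝ᵥ u) * (v ⬝ᵥ v) := by
    simpa [dotProduct, sq] using Finset.sum_mul_sq_le_sq_mul_sq Finset.univ u v
  refine abs_le_of_sq_le_sq ?_ (mul_nonneg ha hb)
  calc (u ⬝ᵥ v) ^ 2 ≤ _ := h
    _ ≤ a ^ 2 * b ^ 2 := mul_le_mul hu hv (dot_self_nonneg v) (sq_nonneg a)
    _ = (a * b) ^ 2 := by ring

lemma sq_apply_le_dot_self (u : ι → ℝ) (i : ι) : u i ^ 2 ≤ u ⬝ᵥ u := by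
  rw [sq]
  exact Finset.single_le_sum (f := fun i => u i * u i) (fun j _ => mul_self_nonneg (u j))
    (Finset.mem_univ i)

lemma dot_self_le_sq_sum_abs (u : ι → ℝ) : u ⬝ᵥ u ≤ (∑ i, |u i|) ^ 2 := by
  have : u ⬝ᵥ u = ∑ i, |u i| ^ 2 := by simp [dotProduct, sq]
  rw [this]
  exact Finset.sum_sq_le_sq_sum_of_nonneg fun i _ => abs_nonneg _

lemma dot_transpose_mulVec (A : Matrix κ ι ℝ) (x : ι → ℝ) (y : κ → ℝ) :
    x ⬝ᵥ Aᵀ *ᵥ y = (A *ᵥ x) ⬝ᵥ y := by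
  rw [Matrix.mulVec_transpose, dotProduct_comm, ← Matrix.dotProduct_mulVec, dotProduct_comm]

lemma dot_self_le_of_abs_le {u : ι → ℝ} {a : ℝ} (h : ∀ i, |u i| ≤ a) :
    u ⬝ᵥ u ≤ Fintype.card ι * a ^ 2 := by
  have : ∑ _i : ι, a ^ 2 = Fintype.card ι * a ^ 2 := by simp
  rw [← this]
  exact Finset.sum_le_sum fun i _ => by
    rw [← sq]; exact sq_le_sq' (by linarith [neg_abs_le (u i), h i]) (le_of_abs_le (h i))

end DotProduct

/-! ### From singular values and eigenvalues to norm bounds. -/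

section Spectral

variable {m n : ℕ}

lemma inner_toLp (u v : Fin n → ℝ) :
    inner ℝ (WithLp.toLp 2 u : EuclideanSpace ℝ (Fin n)) (WithLp.toLp 2 v) = u ⬝ᵥ v := by
  simp [EuclideanSpace.inner_eq_star_dotProduct, dotProduct_comm]

lemma norm_sq_toLp (u : Fin n → ℝ) :
    ‖(WithLp.toLp 2 u : EuclideanSpace ℝ (Fin n))‖ ^ 2 = u ⬝ᵥ u := by
  rw [← real_inner_self_eq_norm_sq, inner_toLp]

/-- Expanding in an eigenbasis of the adjoint composed with `T` turns bounds on singular values into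
bounds on norms. -/
lemma norm_sq_map_eq_sum_singularValues {E F : Type*} [NormedAddCommGroup E]
    [InnerProductSpace ℝ E] [FiniteDimensional ℝ E] [NormedAddCommGroup F]
    [InnerProductSpace ℝ F] [FiniteDimensional ℝ F] (T : E →ₗ[ℝ] F) {n : ℕ}
    (hn : Module.finrank ℝ E = n) (x : E) :
    ‖T x‖ ^ 2 = ∑ i : Fin n, T.singularValues i ^ 2 *
      inner ℝ (T.isSymmetric_adjoint_comp_self.eigenvectorBasis hn i) x ^ 2 := by
  set B := T.isSymmetric_adjoint_comp_self.eigenvectorBasis hn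
  have h1 : ‖T x‖ ^ 2 = inner ℝ x ((T.adjoint ∘ₗ T) x) := by
    rw [LinearMap.comp_apply, LinearMap.adjoint_inner_right, real_inner_self_eq_norm_sq]
  rw [h1, ← B.sum_inner_mul_inner]
  refine Finset.sum_congr rfl fun i _ => ?_
  have h2 : inner ℝ (B i) ((T.adjoint ∘ₗ T) x) = T.singularValues i ^ 2 * inner ℝ (B i) x := by
    rw [← T.isSymmetric_adjoint_comp_self (B i) x,
      T.isSymmetric_adjoint_comp_self.apply_eigenvectorBasis hn i, T.sq_singularValues_fin hn i]
    simp [B, inner_smul_left]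
  rw [h2, real_inner_comm]; ring

lemma exists_preimage_of_singularValues {A : Matrix (Fin m) (Fin n) ℝ} {a : ℝ} (ha : 0 ≤ a)
    (hr : A.rank = m) (hs : ∀ i < m, a ≤ (Matrix.toEuclideanLin A).singularValues i)
    (r : Fin m → ℝ) : ∃ x : Fin n → ℝ, A *ᵥ x = r ∧ a ^ 2 * (x ⬝ᵥ x) ≤ r ⬝ᵥ r := by
  set T := Matrix.toEuclideanLin A with hT
  have hn : Module.finrank ℝ (EuclideanSpace ℝ (Fin n)) = n := by simp
  set B := T.isSymmetric_adjoint_comp_self.eigenvectorBasis hn with hB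
  have hrange : Module.finrank ℝ T.range = m := by
    have h := Matrix.rank_eq_finrank_range_toLin A (EuclideanSpace.basisFun (Fin m) ℝ).toBasis
      (EuclideanSpace.basisFun (Fin n) ℝ).toBasis
    rw [hr, ← Matrix.toEuclideanLin_eq_toLin_orthonormal] at h
    exact h.symm
  have hsurj : Function.Surjective T := by
    rw [← LinearMap.range_eq_top]
    apply Submodule.eq_top_of_finrank_eq
    simp [hrange]
  obtain ⟨x₀, hx₀⟩ := hsurj (WithLp.toLp 2 r)
  -- The rank is `m`, so the singular values of index at least `m` vanish. Dropping these components
  -- of a preimage keeps its image, and only singular values that are at least `a` remain.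
  have hker : ∀ i : Fin n, m ≤ i → T (B i) = 0 := by
    intro i hi
    have := norm_sq_map_eq_sum_singularValues T hn (B i)
    rw [Finset.sum_eq_single i] at this
    · rw [T.singularValues_eq_zero_iff_le_finrank_range.2 (hrange.le.trans hi)] at this
      simpa using this
    · intro j _ hj
      rw [← hB, B.inner_eq_zero hj]; simp
    · simp
  set x := ∑ i : Fin n, if (i : ℕ) < m then inner ℝ (B i) x₀ • B i else 0 with hx
  have hTx : T x = WithLp.toLp 2 r := by
    rw [← hx₀]
    conv_rhs => rw [← B.sum_repr' x₀]
    rw [hx, map_sum, map_sum]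
    refine Finset.sum_congr rfl fun i _ => ?_
    split_ifs with h
    · rfl
    · simp [hker i (not_lt.1 h)]
  have hinner : ∀ i, inner ℝ (B i) x = if (i : ℕ) < m then inner ℝ (B i) x₀ else 0 := by
    intro i
    rw [hx, inner_sum, Finset.sum_eq_single i]
    · split_ifs <;> simp [inner_smul_right]
    · intro j _ hj
      split_ifs <;> simp [inner_smul_right, B.inner_eq_zero hj.symm]
    · simp
  refine ⟨x.ofLp, ?_, ?_⟩
  · have := congrArg WithLp.ofLp hTx
    simpa [hT] using this
  · rw [← norm_sq_toLp, ← norm_sq_toLp r, ← hTx, norm_sq_map_eq_sum_singularValues T hn,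
      ← B.sum_sq_norm_inner_right, Finset.mul_sum]
    refine Finset.sum_le_sum fun i _ => ?_
    rw [WithLp.toLp_ofLp, ← hB, hinner i]
    split_ifs with h
    · rw [Real.norm_eq_abs, sq_abs]
      exact mul_le_mul_of_nonneg_right (pow_le_pow_left₀ ha (hs i h) 2) (sq_nonneg _)
    · simp

lemma mulVec_dot_self_le_of_singularValues {A : Matrix (Fin m) (Fin n) ℝ} {a : ℝ} (ha : 0 ≤ a)
    (hr : A.rank = m) (hs : ∀ i < m, (Matrix.toEuclideanLin A).singularValues i ≤ a)
    (x : Fin n → ℝ) : (A *ᵥ x) ⬝ᵥ (A *ᵥ x) ≤ a ^ 2 * (x ⬝ᵥ x) := by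
  set T := Matrix.toEuclideanLin A with hT
  have hn : Module.finrank ℝ (EuclideanSpace ℝ (Fin n)) = n := by simp
  set B := T.isSymmetric_adjoint_comp_self.eigenvectorBasis hn with hB
  have hall : ∀ i, T.singularValues i ≤ a := by
    intro i
    -- For `m = 0` the hypothesis on singular values is vacuous, but the map is zero.
    rcases Nat.eq_zero_or_pos m with rfl | hm
    · rw [show T = 0 from LinearMap.ext fun _ => Subsingleton.elim _ _]; simpa using ha
    · exact (T.singularValues_antitone (Nat.zero_le i)).trans (hs 0 hm)
  have h1 : WithLp.toLp 2 (A *ᵥ x) = T (WithLp.toLp 2 x) := by simp [hT]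
  rw [← norm_sq_toLp, ← norm_sq_toLp x, h1, norm_sq_map_eq_sum_singularValues T hn,
      ← B.sum_sq_norm_inner_right, Finset.mul_sum]
  refine Finset.sum_le_sum fun i _ => ?_
  rw [← hB, Real.norm_eq_abs, sq_abs]
  exact mul_le_mul_of_nonneg_right (pow_le_pow_left₀ (T.singularValues_nonneg _) (hall i) 2)
    (sq_nonneg _)

lemma transpose_mulVec_dot_self_le {A : Matrix (Fin m) (Fin n) ℝ} {a : ℝ}
    (h : ∀ x : Fin n → ℝ, (A *ᵥ x) ⬝ᵥ (A *ᵥ x) ≤ a ^ 2 * (x ⬝ᵥ x)) (y : Fin m → ℝ) :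
    (Aᵀ *ᵥ y) ⬝ᵥ (Aᵀ *ᵥ y) ≤ a ^ 2 * (y ⬝ᵥ y) := by
  set v := Aᵀ *ᵥ y with hv
  have h1 : v ⬝ᵥ v = (A *ᵥ v) ⬝ᵥ y := by
    conv_lhs => rw [hv]
    rw [hv, dot_transpose_mulVec]
  by_cases h0 : v ⬝ᵥ v = 0
  · rw [h0]; exact mul_nonneg (sq_nonneg _) (dot_self_nonneg _)
  have hpos : 0 < v ⬝ᵥ v := lt_of_le_of_ne (dot_self_nonneg _) (Ne.symm h0)
  have h2 : (v ⬝ᵥ v) ^ 2 ≤ ((A *ᵥ v) ⬝ᵥ (A *ᵥ v)) * (y ⬝ᵥ y) := by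
    rw [h1]
    simpa [dotProduct, sq] using Finset.sum_mul_sq_le_sq_mul_sq Finset.univ (A *ᵥ v) y
  have h3 := mul_le_mul_of_nonneg_right (h v) (dot_self_nonneg y)
  have h4 : (v ⬝ᵥ v) * (v ⬝ᵥ v) ≤ (v ⬝ᵥ v) * (a ^ 2 * (y ⬝ᵥ y)) := by nlinarith
  exact le_of_mul_le_mul_left h4 hpos

/-- A preimage `x` of `y` gives `‖y‖² = xᵀAᵀy`; Young's inequality with weight `a²` then absorbs
`x`. -/
lemma le_transpose_mulVec_dot_self {A : Matrix (Fin m) (Fin n) ℝ} {a : ℝ}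
    (h : ∀ r : Fin m → ℝ, ∃ x : Fin n → ℝ, A *ᵥ x = r ∧ a ^ 2 * (x ⬝ᵥ x) ≤ r ⬝ᵥ r)
    (y : Fin m → ℝ) : a ^ 2 * (y ⬝ᵥ y) ≤ (Aᵀ *ᵥ y) ⬝ᵥ (Aᵀ *ᵥ y) := by
  obtain ⟨x, hx, hxy⟩ := h y
  have h1 : y ⬝ᵥ y = x ⬝ᵥ Aᵀ *ᵥ y := by rw [dot_transpose_mulVec, hx]
  have h2 := two_dot_le (a ^ 2 • x) (Aᵀ *ᵥ y)
  rw [smul_dot_self, smul_dotProduct, ← h1, smul_eq_mul] at h2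
  nlinarith [sq_nonneg a]

lemma posSemidef_mulVec_dot_self_le {Q : Matrix (Fin n) (Fin n) ℝ} (hQ : Q.PosSemidef) {q : ℝ}
    (h : ∀ i, hQ.isHermitian.eigenvalues i ≤ q) (x : Fin n → ℝ) :
    (Q *ᵥ x) ⬝ᵥ (Q *ᵥ x) ≤ q ^ 2 * (x ⬝ᵥ x) := by
  set B := hQ.isHermitian.eigenvectorBasis with hB
  rw [← norm_sq_toLp, ← norm_sq_toLp x, ← B.sum_sq_norm_inner_right, ← B.sum_sq_norm_inner_right,
    Finset.mul_sum]
  refine Finset.sum_le_sum fun i _ => ?_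
  have h1 : inner ℝ (B i) (WithLp.toLp 2 (Q *ᵥ x))
      = hQ.isHermitian.eigenvalues i * inner ℝ (B i) (WithLp.toLp 2 x) := by
    have h2 := hQ.isHermitian.mulVec_eigenvectorBasis i
    have h3 : Qᵀ = Q := by simpa using hQ.isHermitian.eq
    rw [← WithLp.toLp_ofLp 2 (B i), inner_toLp, inner_toLp]
    conv_lhs => rw [← h3]
    rw [dot_transpose_mulVec, hB, h2, smul_dotProduct, smul_eq_mul]
  rw [h1, norm_mul, mul_pow]
  refine mul_le_mul_of_nonneg_right ?_ (sq_nonneg _)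
  rw [Real.norm_eq_abs, sq_abs]
  exact pow_le_pow_left₀ (hQ.eigenvalues_nonneg i) (h i) 2

end Spectral

/-! ### Farkas' lemma, KKT multipliers and complementarity of the optimum. -/

section Duality

/-- **Farkas' lemma** for finitely many linear functionals. -/
lemma farkas {V ι : Type*} [AddCommGroup V] [Module ℝ V] (s : Finset ι)
    (a : ι → Module.Dual ℝ V) (b : Module.Dual ℝ V)
    (h : ∀ x, (∀ i ∈ s, 0 ≤ a i x) → 0 ≤ b x) :
    ∃ t : ι → ℝ, (∀ i, 0 ≤ t i) ∧ b = ∑ i ∈ s, t i • a i := by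
  classical
  induction s using Finset.induction_on generalizing a b with
  | empty =>
    refine ⟨0, fun _ => le_rfl, ?_⟩
    ext x
    have h1 := h x (by simp)
    have h2 := h (-x) (by simp)
    rw [map_neg] at h2
    simp; linarith
  | insert k s hk ih =>
    by_cases hb : ∀ x, (∀ i ∈ s, 0 ≤ a i x) → 0 ≤ b x
    · obtain ⟨t, ht, hbt⟩ := ih a b hb
      refine ⟨Function.update t k 0, fun i => ?_, ?_⟩
      · by_cases hi : i = k
        · subst hi; simp
        · simpa [hi] using ht i
      · rw [Finset.sum_insert hk, hbt]
        simp only [Function.update_self, zero_smul, zero_add]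
        refine Finset.sum_congr rfl fun i hi => ?_
        rw [Function.update_of_ne (ne_of_mem_of_not_mem hi hk)]
    -- A point where `b` is negative on the smaller cone must violate `a k`. Scaled to `a k x₀ =
    -- -1`, it defines the projection `x ↦ x + a k x • x₀` onto the kernel of `a k`; the induction
    -- hypothesis applies to the functionals composed with this projection.
    · push Not at hb
      obtain ⟨x₁, hx₁, hbx₁⟩ := hb
      have hk₁ : a k x₁ < 0 := by
        by_contra hcon
        refine absurd (h x₁ fun i hi => ?_) (not_le.2 hbx₁)
        rcases Finset.mem_insert.1 hi with rfl | hi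
        · exact not_lt.1 hcon
        · exact hx₁ i hi
      set x₀ := (-(a k x₁))⁻¹ • x₁ with hx₀
      have hpos : 0 < (-(a k x₁))⁻¹ := inv_pos.2 (by linarith)
      have hk₀ : a k x₀ = -1 := by
        rw [hx₀, map_smul, smul_eq_mul, inv_neg, neg_mul, inv_mul_cancel₀ hk₁.ne]
      have ha₀ : ∀ i ∈ s, 0 ≤ a i x₀ := fun i hi => by
        rw [hx₀, map_smul]; exact mul_nonneg hpos.le (hx₁ i hi)
      have hb₀ : b x₀ < 0 := by
        rw [hx₀, map_smul]; exact mul_neg_of_pos_of_neg hpos hbx₁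
      obtain ⟨t, ht, hbt⟩ := ih (fun i => a i + a i x₀ • a k) (b + b x₀ • a k) (by
        intro x hx
        have := h (x + a k x • x₀) fun i hi => by
          rcases Finset.mem_insert.1 hi with rfl | hi
          · simp [hk₀]
          · have := hx i hi
            simp only [LinearMap.add_apply, LinearMap.smul_apply, smul_eq_mul] at this
            simp only [map_add, map_smul, smul_eq_mul]; linarith
        simp only [map_add, map_smul, smul_eq_mul] at this
        simp only [LinearMap.add_apply, LinearMap.smul_apply, smul_eq_mul]; linarith)
      refine ⟨Function.update t k (∑ i ∈ s, t i * a i x₀ - b x₀), fun i => ?_, ?_⟩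
      · by_cases hi : i = k
        · subst hi
          have : 0 ≤ ∑ j ∈ s, t j * a j x₀ :=
            Finset.sum_nonneg fun j hj => mul_nonneg (ht j) (ha₀ j hj)
          simp; linarith
        · simpa [hi] using ht i
      · have hsum : ∑ i ∈ s, Function.update t k (∑ i ∈ s, t i * a i x₀ - b x₀) i • a i
            = ∑ i ∈ s, t i • a i := Finset.sum_congr rfl fun i hi => by
          rw [Function.update_of_ne (ne_of_mem_of_not_mem hi hk)]
        rw [Finset.sum_insert hk, hsum, Function.update_self]
        have : b = ∑ i ∈ s, t i • (a i + a i x₀ • a k) - b x₀ • a k := by rw [← hbt]; abel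
        refine this.trans ?_
        ext x
        simp only [LinearMap.sub_apply, LinearMap.add_apply, LinearMap.smul_apply,
          LinearMap.sum_apply, smul_eq_mul, mul_add, Finset.sum_add_distrib, sub_mul,
          Finset.sum_mul, mul_assoc]
        ring

/-- The first-order term dominates for small `t`; this converts minimality along a segment into a
sign of the directional derivative. -/
lemma nonneg_of_forall_small {g h ε : ℝ} (hε : 0 < ε)
    (H : ∀ t, 0 < t → t ≤ ε → 0 ≤ t * g + t ^ 2 * h) : 0 ≤ g := by
  by_contra hg
  push Not at hg
  set t := min ε (-g / (2 * (|h| + 1))) with ht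
  have h1 : 0 < |h| + 1 := by positivity
  have h2 : 0 < t := lt_min hε (div_pos (by linarith) (by linarith))
  have h3 := H t h2 (min_le_left _ _)
  have h4 : t * (2 * (|h| + 1)) ≤ -g := by
    rw [← le_div_iff₀ (by linarith)]; exact min_le_right _ _
  have h5 : t * h ≤ t * |h| := mul_le_mul_of_nonneg_left (le_abs_self h) h2.le
  have h6 : 0 ≤ t * (g + t * h) := by linarith [h3, show t * (g + t * h) = t * g + t ^ 2 * h by ring]
  have h7 : 0 ≤ g + t * h := nonneg_of_mul_nonneg_right h6 h2
  nlinarith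

variable {m n : ℕ} (P : Problem m n)

lemma psd_dot_nonneg (u : Fin n → ℝ) : 0 ≤ u ⬝ᵥ P.Q *ᵥ u := by
  simpa using P.psd.dotProduct_mulVec_nonneg u

lemma psd_dot_comm (u v : Fin n → ℝ) : u ⬝ᵥ P.Q *ᵥ v = v ⬝ᵥ P.Q *ᵥ u := by
  have h3 : P.Qᵀ = P.Q := by simpa using P.psd.isHermitian.eq
  conv_lhs => rw [← h3]
  rw [dot_transpose_mulVec, dotProduct_comm]

lemma primalObj_eq_dualObj_add {w : Triple m n} (h1 : P.A *ᵥ w.x = P.b)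
    (h2 : P.dualMap w = P.c) : P.primalObj w.x = P.dualObj w + w.x ⬝ᵥ w.z := by
  simp only [Problem.primalObj, Problem.dualObj, ← h2, Problem.dualMap, add_dotProduct,
    neg_dotProduct, ← h1]
  rw [dotProduct_comm (P.Aᵀ *ᵥ w.y), dot_transpose_mulVec, dotProduct_comm (P.Q *ᵥ w.x),
    dotProduct_comm w.z]
  ring

lemma primalObj_add_smul (x d : Fin n → ℝ) (t : ℝ) :
    P.primalObj (x + t • d) = P.primalObj x + t * ((P.c + P.Q *ᵥ x) ⬝ᵥ d)
      + t ^ 2 * (1 / 2 * (d ⬝ᵥ P.Q *ᵥ d)) := by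
  simp only [Problem.primalObj, Matrix.mulVec_add, Matrix.mulVec_smul, dotProduct_add,
    add_dotProduct, dotProduct_smul, smul_dotProduct, smul_eq_mul]
  rw [psd_dot_comm P x d, dotProduct_comm (P.Q *ᵥ x) d]
  ring

/-- A solution of the primal problem satisfies the KKT conditions with some multipliers. -/
lemma exists_multipliers {x : Fin n → ℝ} (hx : P.primalFeasible x)
    (hmin : ∀ x', P.primalFeasible x' → P.primalObj x ≤ P.primalObj x') :
    ∃ y z, P.dualMap ⟨x, y, z⟩ = P.c ∧ (∀ i, 0 ≤ z i) ∧ x ⬝ᵥ z = 0 := by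
  classical
  obtain ⟨hAx, hx0⟩ := hx
  let pr : Fin n → Module.Dual ℝ (Fin n → ℝ) := fun i => LinearMap.proj i
  let row : Fin m → Module.Dual ℝ (Fin n → ℝ) := fun j => LinearMap.proj j ∘ₗ P.A.mulVecLin
  -- These functionals cut out the feasible directions at `x`: both signs of each row encode `A d =
  -- 0`, and only active coordinates are constrained. Inactive ones get the zero functional, so
  -- their multiplier can be set to zero, which yields complementarity.
  let f : Fin m ⊕ Fin m ⊕ Fin n → Module.Dual ℝ (Fin n → ℝ) :=
    Sum.elim row (Sum.elim (fun j => -row j) (fun i => if x i = 0 then pr i else 0))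
  let g : Module.Dual ℝ (Fin n → ℝ) := ∑ i, (P.c + P.Q *ᵥ x) i • pr i
  have hg : ∀ d, g d = (P.c + P.Q *ᵥ x) ⬝ᵥ d := fun d => by simp [g, pr, dotProduct]
  obtain ⟨t, ht, hbt⟩ := farkas Finset.univ f g (by
    intro d hd
    have hAd : P.A *ᵥ d = 0 := by
      ext j
      have h1 := hd (Sum.inl j) (Finset.mem_univ _)
      have h2 := hd (Sum.inr (Sum.inl j)) (Finset.mem_univ _)
      simp only [f, row, Sum.elim_inl, Sum.elim_inr, LinearMap.neg_apply, LinearMap.comp_apply,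
        Matrix.mulVecLin_apply, LinearMap.proj_apply] at h1 h2
      simp only [Pi.zero_apply]; linarith
    have hact : ∀ i, x i = 0 → 0 ≤ d i := fun i hi => by
      simpa [f, pr, hi] using hd (Sum.inr (Sum.inr i)) (Finset.mem_univ _)
    have hev : ∀ᶠ s in nhdsWithin (0 : ℝ) (Set.Ioi 0), ∀ i, 0 ≤ x i + s * d i := by
      rw [Filter.eventually_all]
      intro i
      rcases (hx0 i).eq_or_lt with h | h
      · filter_upwards [self_mem_nhdsWithin] with s hs
        rw [← h, zero_add]; exact mul_nonneg (le_of_lt hs) (hact i h.symm)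
      · have hc : Filter.Tendsto (fun s : ℝ => x i + s * d i) (nhdsWithin 0 (Set.Ioi 0))
            (nhds (x i + 0 * d i)) :=
          (Continuous.tendsto (by fun_prop) 0).mono_left nhdsWithin_le_nhds
        rw [zero_mul, add_zero] at hc
        filter_upwards [hc.eventually (lt_mem_nhds h)] with s hs using hs.le
    obtain ⟨ε, hε, hεs⟩ := mem_nhdsGT_iff_exists_Ioc_subset.1 hev
    rw [hg]
    refine nonneg_of_forall_small (h := 1 / 2 * (d ⬝ᵥ P.Q *ᵥ d)) hε fun s hs hsε => ?_
    have hmem : ∀ i, 0 ≤ x i + s * d i := hεs ⟨hs, hsε⟩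
    have := hmin (x + s • d) ⟨by rw [Matrix.mulVec_add, Matrix.mulVec_smul, hAd, hAx]; simp, hmem⟩
    rw [primalObj_add_smul] at this
    linarith)
  refine ⟨fun j => t (Sum.inl j) - t (Sum.inr (Sum.inl j)),
    fun i => if x i = 0 then t (Sum.inr (Sum.inr i)) else 0, ?_, ?_, ?_⟩
  · have key : ∀ i, (P.c + P.Q *ᵥ x) i
        = (P.Aᵀ *ᵥ fun j => t (Sum.inl j) - t (Sum.inr (Sum.inl j))) i
          + if x i = 0 then t (Sum.inr (Sum.inr i)) else 0 := by
      intro i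
      have h1 := congrArg (fun φ => φ (Pi.single i 1)) hbt
      simp only [hg, dotProduct_single, mul_one] at h1
      rw [h1]
      simp only [f, pr, row, Fintype.sum_sum_type, Sum.elim_inl, Sum.elim_inr, LinearMap.add_apply,
        LinearMap.sum_apply, LinearMap.smul_apply, LinearMap.neg_apply, LinearMap.comp_apply,
        Matrix.mulVecLin_apply, LinearMap.proj_apply, smul_eq_mul, Matrix.mulVec_single_one,
        Matrix.mulVec, dotProduct, Matrix.transpose_apply, Matrix.col_apply]
      rw [← add_assoc, ← Finset.sum_add_distrib]
      congr 1
      · exact Finset.sum_congr rfl fun j _ => by ring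
      · rw [Finset.sum_eq_single i]
        · split_ifs <;> simp
        · intro j _ hj
          split_ifs <;> simp [hj]
        · simp
    ext i
    have := key i
    simp only [Problem.dualMap, Pi.add_apply, Pi.neg_apply] at this ⊢
    linarith
  · intro i
    dsimp only
    split_ifs
    · exact ht _
    · exact le_rfl
  · refine Finset.sum_eq_zero fun i _ => ?_
    dsimp only
    split_ifs with h
    · rw [h, zero_mul]
    · rw [mul_zero]

/-- KKT multipliers of the primal part form a dual feasible triple with zero gap. Dual optimality of
`w` makes its gap, which equals `xᵀz`, nonpositive. -/
lemma Problem.IsOptimal.complementary {P : Problem m n} {w : Triple m n} (hw : P.IsOptimal w) :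
    w.x ⬝ᵥ w.z = 0 := by
  obtain ⟨⟨hpf, hpm⟩, hdf, hdm⟩ := hw
  obtain ⟨y, z, h1, h2, h3⟩ := exists_multipliers P hpf hpm
  have h4 := hdm ⟨w.x, y, z⟩ ⟨h1, h2⟩
  have h5 := primalObj_eq_dualObj_add P (w := ⟨w.x, y, z⟩) hpf.1 h1
  have h6 := primalObj_eq_dualObj_add P hpf.1 hdf.1
  have h7 : 0 ≤ w.x ⬝ᵥ w.z := Finset.sum_nonneg fun i _ => mul_nonneg (hpf.2 i) (hdf.2 i)
  simp only [h3] at h5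
  linarith

end Duality

/-! ### Solvability of the proximal subproblem with shifted bounds. -/

section Proximal

variable {m n : ℕ}

/-- A strongly monotone symmetric linear complementarity problem has a solution. -/
lemma exists_complementary {H : Matrix (Fin n) (Fin n) ℝ} (hH : Hᵀ = H) {μ : ℝ} (hμ : 0 < μ)
    (hmono : ∀ u, μ * (u ⬝ᵥ u) ≤ u ⬝ᵥ H *ᵥ u) (k l : Fin n → ℝ) :
    ∃ x, (∀ i, l i ≤ x i) ∧ (∀ i, 0 ≤ (H *ᵥ x + k) i) ∧ (x - l) ⬝ᵥ (H *ᵥ x + k) = 0 := by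
  set F : (Fin n → ℝ) → ℝ := fun x => 1 / 2 * (x ⬝ᵥ H *ᵥ x) + k ⬝ᵥ x with hF
  have hFc : Continuous F := by
    simp only [hF, dotProduct, Matrix.mulVec]; fun_prop
  have hcoer : ∀ x, μ / 4 * (x ⬝ᵥ x) - (k ⬝ᵥ k) / μ ≤ F x := by
    intro x
    have h1 := hmono x
    have h2 := neg_two_dot_le ((2 / μ) • k) x
    rw [smul_dot_self, smul_dotProduct, smul_eq_mul] at h2
    have h3 : μ / 4 * (-(2 * (2 / μ * (k ⬝ᵥ x)))) ≤ μ / 4 * ((2 / μ) ^ 2 * (k ⬝ᵥ k) + x ⬝ᵥ x) :=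
      mul_le_mul_of_nonneg_left h2 (by positivity)
    have h4 : μ / 4 * (-(2 * (2 / μ * (k ⬝ᵥ x)))) = -(k ⬝ᵥ x) := by field_simp; ring
    have h5 : μ / 4 * ((2 / μ) ^ 2 * (k ⬝ᵥ k) + x ⬝ᵥ x) = (k ⬝ᵥ k) / μ + μ / 4 * (x ⬝ᵥ x) := by
      field_simp; ring
    rw [h4, h5] at h3
    simp only [hF]; linarith
  -- Coercivity gives `F > F l` outside this ball, so a minimiser on the compact set `S` is a
  -- minimiser over all `x ≥ l`.
  set R := max (l ⬝ᵥ l) (4 / μ * (F l + (k ⬝ᵥ k) / μ)) with hR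
  set S : Set (Fin n → ℝ) := {x | (∀ i, l i ≤ x i) ∧ x ⬝ᵥ x ≤ R} with hS
  have hclosed : IsClosed S := by
    have h : S = (⋂ i, {x | l i ≤ x i}) ∩ {x | x ⬝ᵥ x ≤ R} := by ext x; simp [hS]
    rw [h]
    refine (isClosed_iInter fun i => isClosed_le continuous_const (continuous_apply i)).inter
      (isClosed_le ?_ continuous_const)
    simp only [dotProduct]; fun_prop
  have hbdd : Bornology.IsBounded S := by
    rw [isBounded_iff_forall_norm_le]
    refine ⟨√R, fun x hx => ?_⟩
    rw [pi_norm_le_iff_of_nonneg (Real.sqrt_nonneg _)]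
    intro i
    exact Real.abs_le_sqrt ((sq_apply_le_dot_self x i).trans hx.2)
  have hcomp : IsCompact S := Metric.isCompact_of_isClosed_isBounded hclosed hbdd
  have hlS : l ∈ S := ⟨fun _ => le_rfl, le_max_left _ _⟩
  obtain ⟨x, hxS, hxmin⟩ := hcomp.exists_isMinOn ⟨l, hlS⟩ hFc.continuousOn
  have hglob : ∀ x', (∀ i, l i ≤ x' i) → F x ≤ F x' := by
    intro x' hx'
    by_cases h : x' ⬝ᵥ x' ≤ R
    · exact hxmin ⟨hx', h⟩
    · push Not at h
      have h1 : F x ≤ F l := hxmin hlS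
      have h2 := hcoer x'
      have h3 : 4 / μ * (F l + (k ⬝ᵥ k) / μ) < x' ⬝ᵥ x' := (le_max_right _ _).trans_lt h
      have h4 : μ / 4 * (4 / μ * (F l + (k ⬝ᵥ k) / μ)) < μ / 4 * (x' ⬝ᵥ x') :=
        mul_lt_mul_of_pos_left h3 (by positivity)
      have h5 : μ / 4 * (4 / μ * (F l + (k ⬝ᵥ k) / μ)) = F l + (k ⬝ᵥ k) / μ := by field_simp
      linarith
  have hexp : ∀ d t, F (x + t • d) = F x + t * (d ⬝ᵥ (H *ᵥ x + k))
      + t ^ 2 * (1 / 2 * (d ⬝ᵥ H *ᵥ d)) := by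
    intro d t
    have hc : x ⬝ᵥ H *ᵥ d = d ⬝ᵥ H *ᵥ x := by
      conv_lhs => rw [← hH]
      rw [dot_transpose_mulVec, dotProduct_comm]
    simp only [hF, Matrix.mulVec_add, Matrix.mulVec_smul, dotProduct_add, add_dotProduct,
      dotProduct_smul, smul_dotProduct, smul_eq_mul, hc, dotProduct_comm k d]
    ring
  have hvar : ∀ d, (∀ t : ℝ, 0 < t → t ≤ 1 → ∀ i, l i ≤ x i + t * d i) →
      0 ≤ d ⬝ᵥ (H *ᵥ x + k) := by
    intro d hd
    refine nonneg_of_forall_small (h := 1 / 2 * (d ⬝ᵥ H *ᵥ d)) one_pos fun t ht ht1 => ?_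
    have := hglob (x + t • d) (hd t ht ht1)
    rw [hexp] at this
    linarith
  have hg : ∀ i, 0 ≤ (H *ᵥ x + k) i := by
    intro i
    have := hvar (Pi.single i 1) fun t ht _ j => by
      have h1 : (0 : ℝ) ≤ (Pi.single i 1 : Fin n → ℝ) j := by
        by_cases hj : j = i
        · subst hj; simp
        · simp [hj]
      have := hxS.1 j
      have := mul_nonneg ht.le h1
      linarith
    simpa using this
  refine ⟨x, hxS.1, hg, le_antisymm ?_ ?_⟩
  · have := hvar (l - x) fun t _ ht1 i => by
      have := hxS.1 i
      simp only [Pi.sub_apply]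
      nlinarith
    have h2 : (x - l) ⬝ᵥ (H *ᵥ x + k) = -((l - x) ⬝ᵥ (H *ᵥ x + k)) := by
      rw [← neg_dotProduct, neg_sub]
    linarith
  · exact Finset.sum_nonneg fun i _ => mul_nonneg (by
      simp only [Pi.sub_apply]; linarith [hxS.1 i]) (hg i)

/-- The proximal subproblem with shifted sign constraints has a primal-dual solution. -/
lemma exists_proximal (P : Problem m n) {μ : ℝ} (hμ : 0 < μ) (b' lam : Fin m → ℝ)
    (c' zeta lx lz : Fin n → ℝ) :
    ∃ w : Triple m n, P.A *ᵥ w.x + μ • (w.y - lam) = b' ∧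
      P.dualMap w - μ • (w.x - zeta) = c' ∧
      (∀ i, lx i ≤ w.x i) ∧ (∀ i, lz i ≤ w.z i) ∧ (w.x - lx) ⬝ᵥ (w.z - lz) = 0 := by
  have hQ : P.Qᵀ = P.Q := by simpa using P.psd.isHermitian.eq
  -- The primal equation gives `y = lam - μ⁻¹(Ax - b')` and the dual one gives `z`. What remains is
  -- a complementarity problem in `x` with this matrix, whose term `μ • 1` supplies strong
  -- monotonicity.
  set H : Matrix (Fin n) (Fin n) ℝ := P.Q + μ⁻¹ • (P.Aᵀ * P.A) + μ • 1 with hHdef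
  have hHx : ∀ x, H *ᵥ x = P.Q *ᵥ x + μ⁻¹ • (P.Aᵀ *ᵥ (P.A *ᵥ x)) + μ • x := by
    intro x
    simp [hHdef, Matrix.add_mulVec, Matrix.smul_mulVec]
  obtain ⟨x, h1, h2, h3⟩ := exists_complementary (H := H) (μ := μ)
    (by simp [hHdef, hQ, Matrix.transpose_mul]) hμ
    (by
      intro u
      rw [hHx, dotProduct_add, dotProduct_add, dotProduct_smul, dotProduct_smul,
        dot_transpose_mulVec, smul_eq_mul, smul_eq_mul]
      have := psd_dot_nonneg P u
      have := mul_nonneg (inv_pos.2 hμ).le (dot_self_nonneg (P.A *ᵥ u))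
      linarith)
    (c' - P.Aᵀ *ᵥ lam - μ⁻¹ • (P.Aᵀ *ᵥ b') - μ • zeta - lz) lx
  set g := H *ᵥ x + (c' - P.Aᵀ *ᵥ lam - μ⁻¹ • (P.Aᵀ *ᵥ b') - μ • zeta - lz) with hg
  refine ⟨⟨x, lam - μ⁻¹ • (P.A *ᵥ x - b'), g + lz⟩, ?_, ?_, h1, ?_, ?_⟩
  · simp only [sub_sub_cancel_left, smul_neg, smul_smul, mul_inv_cancel₀ hμ.ne', one_smul]
    abel
  · simp only [Problem.dualMap, hg, hHx, Matrix.mulVec_sub, Matrix.mulVec_smul]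
    module
  · intro i
    simpa using h2 i
  · simpa using h3

end Proximal

/-! ### Linear operations on triples. -/

namespace Triple

variable {m n : ℕ}

instance : Add (Triple m n) := ⟨fun u v => ⟨u.x + v.x, u.y + v.y, u.z + v.z⟩⟩
instance : Sub (Triple m n) := ⟨fun u v => ⟨u.x - v.x, u.y - v.y, u.z - v.z⟩⟩
instance : SMul ℝ (Triple m n) := ⟨fun a v => ⟨a • v.x, a • v.y, a • v.z⟩⟩

@[simp] lemma add_x (u v : Triple m n) : (u + v).x = u.x + v.x := rfl
@[simp] lemma add_y (u v : Triple m n) : (u + v).y = u.y + v.y := rfl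
@[simp] lemma add_z (u v : Triple m n) : (u + v).z = u.z + v.z := rfl
@[simp] lemma sub_x (u v : Triple m n) : (u - v).x = u.x - v.x := rfl
@[simp] lemma sub_y (u v : Triple m n) : (u - v).y = u.y - v.y := rfl
@[simp] lemma sub_z (u v : Triple m n) : (u - v).z = u.z - v.z := rfl
@[simp] lemma smul_x (a : ℝ) (v : Triple m n) : (a • v).x = a • v.x := rfl
@[simp] lemma smul_y (a : ℝ) (v : Triple m n) : (a • v).y = a • v.y := rfl
@[simp] lemma smul_z (a : ℝ) (v : Triple m n) : (a • v).z = a • v.z := rfl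

end Triple

/-! ### Bounds for proximal estimates, auxiliary points and iterates. -/

section Bounds

variable {m n : ℕ} (P : Problem m n)

lemma dualMap_add (u v : Triple m n) : P.dualMap (u + v) = P.dualMap u + P.dualMap v := by
  simp only [Problem.dualMap, Triple.add_x, Triple.add_y, Triple.add_z, Matrix.mulVec_add]; abel

lemma dualMap_sub (u v : Triple m n) : P.dualMap (u - v) = P.dualMap u - P.dualMap v := by
  simp only [Problem.dualMap, Triple.sub_x, Triple.sub_y, Triple.sub_z, Matrix.mulVec_sub]; abel

lemma dualMap_smul (a : ℝ) (v : Triple m n) : P.dualMap (a • v) = a • P.dualMap v := by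
  simp only [Problem.dualMap, Triple.smul_x, Triple.smul_y, Triple.smul_z, Matrix.mulVec_smul]
  module

/-- Pairing the dual equation with `d.x` and substituting the primal one for `A d.x` turns the
coupling term into `μ‖d.y‖²`. Residuals are written as multiples of `μ` so that `μ` can be cancelled
later. -/
lemma regularized_dot {d : Triple m n} {μ : ℝ} {p : Fin m → ℝ} {q : Fin n → ℝ}
    (h1 : P.A *ᵥ d.x + μ • d.y = μ • p) (h2 : P.dualMap d - μ • d.x = -(μ • q)) :
    d.x ⬝ᵥ d.z = d.x ⬝ᵥ P.Q *ᵥ d.x + μ * (d.x ⬝ᵥ d.x + d.y ⬝ᵥ d.y)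
      - μ * (q ⬝ᵥ d.x + p ⬝ᵥ d.y) := by
  have hz : d.z = P.Q *ᵥ d.x - P.Aᵀ *ᵥ d.y + μ • d.x - μ • q := by
    simp only [Problem.dualMap] at h2
    linear_combination (norm := module) h2
  have hA : P.A *ᵥ d.x = μ • p - μ • d.y := by
    linear_combination (norm := module) h1
  conv_lhs => rw [hz]
  simp only [dotProduct_sub, dotProduct_add, dot_transpose_mulVec, hA, sub_dotProduct,
    smul_dotProduct, dotProduct_smul, smul_eq_mul, dotProduct_comm q]
  ring

lemma regularized_le {d : Triple m n} {μ : ℝ} (hμ : 0 ≤ μ) {p : Fin m → ℝ} {q : Fin n → ℝ}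
    (h1 : P.A *ᵥ d.x + μ • d.y = μ • p) (h2 : P.dualMap d - μ • d.x = -(μ • q)) :
    μ * (d.x ⬝ᵥ d.x + d.y ⬝ᵥ d.y) ≤ 2 * (d.x ⬝ᵥ d.z) + μ * (p ⬝ᵥ p + q ⬝ᵥ q) := by
  have h3 := regularized_dot P h1 h2
  have h4 := psd_dot_nonneg P d.x
  have h5 : μ * (2 * (q ⬝ᵥ d.x)) ≤ μ * (q ⬝ᵥ q + d.x ⬝ᵥ d.x) :=
    mul_le_mul_of_nonneg_left (two_dot_le _ _) hμ
  have h6 : μ * (2 * (p ⬝ᵥ d.y)) ≤ μ * (p ⬝ᵥ p + d.y ⬝ᵥ d.y) :=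
    mul_le_mul_of_nonneg_left (two_dot_le _ _) hμ
  linarith

lemma regularized_homogeneous_le {d : Triple m n} {μ : ℝ} (h1 : P.A *ᵥ d.x + μ • d.y = 0)
    (h2 : P.dualMap d - μ • d.x = 0) :
    μ * (d.x ⬝ᵥ d.x + d.y ⬝ᵥ d.y) ≤ d.x ⬝ᵥ d.z := by
  have h3 := regularized_dot P (p := 0) (q := 0) (by simpa using h1) (by simpa using h2)
  have h4 := psd_dot_nonneg P d.x
  simp only [zero_dotProduct] at h3
  linarith

/-- The quantitative information on a problem, with the complementary reference solution `v`. -/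
structure Regular (a₁ a₂ q Cs : ℝ) (P : Problem m n) (v : Triple m n) : Prop where
  pos : 1 ≤ (n : ℝ)
  le : (m : ℝ) ≤ n
  preimage : ∀ r : Fin m → ℝ, ∃ x : Fin n → ℝ, P.A *ᵥ x = r ∧ a₁ ^ 2 * (x ⬝ᵥ x) ≤ r ⬝ᵥ r
  lower : ∀ y, a₁ ^ 2 * (y ⬝ᵥ y) ≤ (P.Aᵀ *ᵥ y) ⬝ᵥ (P.Aᵀ *ᵥ y)
  upper : ∀ y, (P.Aᵀ *ᵥ y) ⬝ᵥ (P.Aᵀ *ᵥ y) ≤ a₂ ^ 2 * (y ⬝ᵥ y)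
  upper' : ∀ x, (P.A *ᵥ x) ⬝ᵥ (P.A *ᵥ x) ≤ a₂ ^ 2 * (x ⬝ᵥ x)
  quad : ∀ x, (P.Q *ᵥ x) ⬝ᵥ (P.Q *ᵥ x) ≤ q ^ 2 * (x ⬝ᵥ x)
  primal : P.A *ᵥ v.x = P.b
  dual : P.dualMap v = P.c
  x_nonneg : ∀ i, 0 ≤ v.x i
  x_le : ∀ i, v.x i ≤ Cs
  z_nonneg : ∀ i, 0 ≤ v.z i
  z_le : ∀ i, v.z i ≤ Cs
  compl : ∀ i, v.x i * v.z i = 0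
  y_sq : v.y ⬝ᵥ v.y ≤ Cs ^ 2 * n

/-- A triple whose `x` and `z` components lie in `[δ, 2ρ]`. -/
structure Interior (δ ρ Y : ℝ) (e : Triple m n) : Prop where
  x_ge : ∀ i, δ ≤ e.x i
  x_le : ∀ i, e.x i ≤ 2 * ρ
  z_ge : ∀ i, δ ≤ e.z i
  z_le : ∀ i, e.z i ≤ 2 * ρ
  y_sq : e.y ⬝ᵥ e.y ≤ Y * n

variable {P} {a₁ a₂ q Cs δ ρ Y : ℝ} {v e : Triple m n}

/-- The segment between the reference solution and an interior triple. -/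
def segment (v e : Triple m n) (θ : ℝ) : Triple m n := (1 - θ) • v + θ • e

lemma card_mul_sq {u : Fin n → ℝ} {a : ℝ} (h : ∀ i, |u i| ≤ a) : u ⬝ᵥ u ≤ a ^ 2 * n := by
  have := dot_self_le_of_abs_le h
  rw [Fintype.card_fin] at this; linarith

lemma segment_bound (hP : Regular a₁ a₂ q Cs P v) (hδ : 0 < δ) (he : Interior δ ρ Y e) {θ : ℝ}
    (h0 : 0 ≤ θ) (h1 : θ ≤ 1) :
    (segment v e θ).x ⬝ᵥ (segment v e θ).x ≤ (Cs + 2 * ρ) ^ 2 * n ∧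
    (segment v e θ).z ⬝ᵥ (segment v e θ).z ≤ (Cs + 2 * ρ) ^ 2 * n ∧
    (segment v e θ).y ⬝ᵥ (segment v e θ).y ≤ (2 * Cs ^ 2 + 2 * Y) * n := by
  have aux : ∀ a b : ℝ, 0 ≤ a → a ≤ Cs → 0 ≤ b → b ≤ 2 * ρ →
      |(1 - θ) * a + θ * b| ≤ Cs + 2 * ρ := fun a b ha ha' hb hb' => by
    rw [abs_of_nonneg (add_nonneg (mul_nonneg (by linarith) ha) (mul_nonneg h0 hb))]
    nlinarith
  refine ⟨card_mul_sq fun i => ?_, card_mul_sq fun i => ?_, ?_⟩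
  · simpa [segment] using
      aux _ _ (hP.x_nonneg i) (hP.x_le i) (hδ.le.trans (he.x_ge i)) (he.x_le i)
  · simpa [segment] using
      aux _ _ (hP.z_nonneg i) (hP.z_le i) (hδ.le.trans (he.z_ge i)) (he.z_le i)
  · have h2 := add_dot_self_le ((1 - θ) • v.y) (θ • e.y)
    rw [smul_dot_self, smul_dot_self] at h2
    have h3 : (1 - θ) ^ 2 * (v.y ⬝ᵥ v.y) ≤ 1 * (Cs ^ 2 * n) :=
      mul_le_mul (by nlinarith) hP.y_sq (dot_self_nonneg _) zero_le_one
    have h4 : θ ^ 2 * (e.y ⬝ᵥ e.y) ≤ 1 * (Y * n) :=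
      mul_le_mul (by nlinarith) he.y_sq (dot_self_nonneg _) zero_le_one
    simp only [segment, Triple.add_y, Triple.smul_y]
    linarith

lemma le_segment_x (hP : Regular a₁ a₂ q Cs P v) (he : Interior δ ρ Y e) {θ : ℝ}
    (h0 : 0 ≤ θ) (h1 : θ ≤ 1) (i : Fin n) : θ * δ ≤ (segment v e θ).x i := by
  have := mul_nonneg (sub_nonneg.2 h1) (hP.x_nonneg i)
  have := mul_le_mul_of_nonneg_left (he.x_ge i) h0
  simp [segment]; linarith

lemma le_segment_z (hP : Regular a₁ a₂ q Cs P v) (he : Interior δ ρ Y e) {θ : ℝ}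
    (h0 : 0 ≤ θ) (h1 : θ ≤ 1) (i : Fin n) : θ * δ ≤ (segment v e θ).z i := by
  have := mul_nonneg (sub_nonneg.2 h1) (hP.z_nonneg i)
  have := mul_le_mul_of_nonneg_left (he.z_ge i) h0
  simp [segment]; linarith

/-- Complementarity of `v` removes the only product without a factor `θ`. -/
lemma segment_dot_le (hP : Regular a₁ a₂ q Cs P v) (hδ : 0 < δ) (he : Interior δ ρ Y e) {θ : ℝ}
    (h0 : 0 ≤ θ) (h1 : θ ≤ 1) :
    (segment v e θ).x ⬝ᵥ (segment v e θ).z ≤ θ * ((4 * ρ * Cs + 4 * ρ ^ 2) * n) := by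
  have : ∀ i, (segment v e θ).x i * (segment v e θ).z i ≤ θ * (4 * ρ * Cs + 4 * ρ ^ 2) := by
    intro i
    have hex := hδ.le.trans (he.x_ge i)
    have hez := hδ.le.trans (he.z_ge i)
    have hρ : 0 ≤ 2 * ρ := hex.trans (he.x_le i)
    have e1 : v.x i * e.z i ≤ Cs * (2 * ρ) :=
      mul_le_mul (hP.x_le i) (he.z_le i) hez ((hP.x_nonneg i).trans (hP.x_le i))
    have e2 : v.z i * e.x i ≤ Cs * (2 * ρ) :=
      mul_le_mul (hP.z_le i) (he.x_le i) hex ((hP.z_nonneg i).trans (hP.z_le i))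
    have e3 : e.x i * e.z i ≤ (2 * ρ) * (2 * ρ) := mul_le_mul (he.x_le i) (he.z_le i) hez hρ
    have e4 : θ * (1 - θ) * (v.x i * e.z i + v.z i * e.x i)
        ≤ θ * 1 * (v.x i * e.z i + v.z i * e.x i) :=
      mul_le_mul_of_nonneg_right (mul_le_mul_of_nonneg_left (by linarith) h0)
        (add_nonneg (mul_nonneg (hP.x_nonneg i) hez) (mul_nonneg (hP.z_nonneg i) hex))
    have e5 : θ * θ * (e.x i * e.z i) ≤ θ * 1 * (e.x i * e.z i) :=
      mul_le_mul_of_nonneg_right (mul_le_mul_of_nonneg_left h1 h0) (mul_nonneg hex hez)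
    have e6 := mul_le_mul_of_nonneg_left (add_le_add (add_le_add e1 e2) e3) h0
    have e7 : (segment v e θ).x i * (segment v e θ).z i = (1 - θ) ^ 2 * (v.x i * v.z i)
        + θ * (1 - θ) * (v.x i * e.z i + v.z i * e.x i) + θ * θ * (e.x i * e.z i) := by
      simp only [segment, Triple.add_x, Triple.smul_x, Triple.add_z, Triple.smul_z,
        Pi.add_apply, Pi.smul_apply, smul_eq_mul]; ring
    rw [e7, hP.compl i]
    linarith
  refine (Finset.sum_le_sum fun i _ => this i).trans (le_of_eq ?_)
  simp; ring

/-- Iterates that satisfy the unregularized perturbed equations are bounded. -/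
lemma unregularized_bound (ha₁ : 0 < a₁) (hδ : 0 < δ) (hρ : 0 < ρ) (hCs : 0 ≤ Cs) (hY : 0 ≤ Y) :
    ∃ K, 0 ≤ K ∧ ∀ (m n : ℕ) (P : Problem m n) (v e w : Triple m n) (θ : ℝ),
      Regular a₁ a₂ q Cs P v → Interior δ ρ Y e → 0 < θ → θ ≤ 1 →
      (∀ i, 0 < w.x i) → (∀ i, 0 < w.z i) →
      P.A *ᵥ w.x = P.A *ᵥ (segment v e θ).x → P.dualMap w = P.dualMap (segment v e θ) →
      w.x ⬝ᵥ w.z = n * (θ * ρ ^ 2) → w.x ⬝ᵥ w.x + w.y ⬝ᵥ w.y ≤ K * n ^ 2 := by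
  set k₁ := (5 * ρ ^ 2 + 4 * ρ * Cs) / δ with hk₁
  set k₂ := 2 * k₁ ^ 2 + 2 * (Cs + 2 * ρ) ^ 2 with hk₂
  refine ⟨k₁ ^ 2 + (2 * ((2 * q ^ 2 * k₂ + 2 * k₂) / a₁ ^ 2) + 2 * (2 * Cs ^ 2 + 2 * Y)),
    by positivity, ?_⟩
  intro m n P v e w θ hP he h0 h1 hx hz hA hD hμ
  have hn := hP.pos
  have hnn : (n : ℝ) ≤ n ^ 2 := by nlinarith
  set r := segment v e θ with hr
  -- The equations carry no proximal term here, so the monotonicity estimate is used with `μ = 0`.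
  have hd : 0 ≤ (w - r).x ⬝ᵥ (w - r).z := by
    have := regularized_homogeneous_le P (d := w - r) (μ := 0)
      (by simp [Matrix.mulVec_sub, hA]) (by simp [dualMap_sub, hD])
    simpa using this
  obtain ⟨hrx, hrz, hry⟩ := segment_bound hP hδ he h0.le h1
  have hrr := segment_dot_le hP hδ he h0.le h1
  rw [← hr] at hrx hrz hry hrr
  have hsum : θ * δ * (∑ i, w.x i + ∑ i, w.z i) ≤ r.x ⬝ᵥ w.z + r.z ⬝ᵥ w.x := by
    rw [add_comm, mul_add, Finset.mul_sum, Finset.mul_sum]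
    exact add_le_add
      (Finset.sum_le_sum fun i _ =>
        mul_le_mul_of_nonneg_right (le_segment_x hP he h0.le h1 i) (hz i).le)
      (Finset.sum_le_sum fun i _ =>
        mul_le_mul_of_nonneg_right (le_segment_z hP he h0.le h1 i) (hx i).le)
  have hsx : 0 ≤ ∑ i, w.x i := Finset.sum_nonneg fun i _ => (hx i).le
  have hsz : 0 ≤ ∑ i, w.z i := Finset.sum_nonneg fun i _ => (hz i).le
  -- Both products `wᵀw` and `rᵀr` are O(θn), and the components of the segment are at least `θδ`:
  -- the factor `θ` cancels.
  have hS : ∑ i, w.x i + ∑ i, w.z i ≤ k₁ * n := by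
    have h2 : θ * (δ * (∑ i, w.x i + ∑ i, w.z i)) ≤ θ * ((5 * ρ ^ 2 + 4 * ρ * Cs) * n) := by
      simp only [Triple.sub_x, Triple.sub_z, sub_dotProduct, dotProduct_sub,
        dotProduct_comm w.x r.z] at hd
      linarith
    have h3 := le_of_mul_le_mul_left h2 h0
    rw [hk₁, div_mul_eq_mul_div, le_div_iff₀ hδ]; linarith
  have hxx : w.x ⬝ᵥ w.x ≤ k₁ ^ 2 * n ^ 2 := by
    refine (dot_self_le_sq_sum_abs _).trans ?_
    rw [Finset.sum_congr rfl fun i _ => abs_of_pos (hx i), ← mul_pow]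
    exact pow_le_pow_left₀ hsx (by linarith) 2
  have hzz : w.z ⬝ᵥ w.z ≤ k₁ ^ 2 * n ^ 2 := by
    refine (dot_self_le_sq_sum_abs _).trans ?_
    rw [Finset.sum_congr rfl fun i _ => abs_of_pos (hz i), ← mul_pow]
    exact pow_le_pow_left₀ hsz (by linarith) 2
  have hmono := mul_le_mul_of_nonneg_left hnn (sq_nonneg (Cs + 2 * ρ))
  have hdx : (w - r).x ⬝ᵥ (w - r).x ≤ k₂ * n ^ 2 := by
    have := sub_dot_self_le w.x r.x
    simp only [Triple.sub_x, hk₂]; linarith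
  have hdz : (w - r).z ⬝ᵥ (w - r).z ≤ k₂ * n ^ 2 := by
    have := sub_dot_self_le w.z r.z
    simp only [Triple.sub_z, hk₂]; linarith
  -- The component `y` is recovered from the dual equation through the lower bound on `Aᵀ`.
  have hdy : (w - r).y ⬝ᵥ (w - r).y ≤ (2 * q ^ 2 * k₂ + 2 * k₂) / a₁ ^ 2 * n ^ 2 := by
    have h2 : P.Aᵀ *ᵥ (w - r).y = P.Q *ᵥ (w - r).x - (w - r).z := by
      have h3 : P.dualMap (w - r) = 0 := by rw [dualMap_sub, hD, sub_self]
      simp only [Problem.dualMap] at h3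
      linear_combination (norm := module) h3
    have h3 := hP.lower (w - r).y
    have h4 := sub_dot_self_le (P.Q *ᵥ (w - r).x) (w - r).z
    have h5 := hP.quad (w - r).x
    have h6 := mul_le_mul_of_nonneg_left hdx (sq_nonneg q)
    rw [h2] at h3
    rw [div_mul_eq_mul_div, le_div_iff₀ (by positivity)]
    linarith
  have hyy : w.y ⬝ᵥ w.y ≤ 2 * ((w - r).y ⬝ᵥ (w - r).y) + 2 * (r.y ⬝ᵥ r.y) := by
    have := add_dot_self_le (w - r).y r.y
    simpa using this
  have := mul_le_mul_of_nonneg_left hnn (show 0 ≤ 2 * Cs ^ 2 + 2 * Y by positivity)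
  linarith

/-- Bounds for the point of the proximal subproblem that replaces the central path. -/
lemma proximal_bound (hδ : 0 < δ) (hρ : 0 < ρ) (hCs : 0 ≤ Cs) (hY : 0 ≤ Y) {R : ℝ} (hR : 0 ≤ R) :
    ∃ K, 0 ≤ K ∧ ∀ (m n : ℕ) (P : Problem m n) (v e : Triple m n) (θ μ : ℝ)
      (zeta : Fin n → ℝ) (lam : Fin m → ℝ),
      Regular a₁ a₂ q Cs P v → Interior δ ρ Y e → 0 ≤ θ → θ ≤ 1 → 0 < μ → μ ≤ ρ ^ 2 →
      zeta ⬝ᵥ zeta + lam ⬝ᵥ lam ≤ R * n ^ 2 →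
      ∃ w : Triple m n, P.A *ᵥ w.x + μ • (w.y - lam) = P.A *ᵥ (segment v e θ).x ∧
        P.dualMap w - μ • (w.x - zeta) = P.dualMap (segment v e θ) ∧
        (∀ i, θ * δ ≤ w.x i) ∧ (∀ i, θ * δ ≤ w.z i) ∧
        w.x ⬝ᵥ w.x + w.y ⬝ᵥ w.y ≤ K * n ^ 2 ∧ w.x ⬝ᵥ w.z ≤ θ * (K * n ^ 2) := by
  set k₀ := (Cs + 2 * ρ) ^ 2 + (2 * Cs ^ 2 + 2 * Y) with hk₀
  set k₁ := 2 * R + 2 * k₀ with hk₁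
  set k₂ := 2 * k₁ + 2 * k₀ with hk₂
  set k₃ := 2 * (4 * q ^ 2 * k₁ + 4 * a₂ ^ 2 * k₁ + 4 * ρ ^ 4 * (k₂ + R)) + 2 * k₀ with hk₃
  have hk₀0 : 0 ≤ k₀ := by positivity
  have hk₁0 : 0 ≤ k₁ := by positivity
  have hk₂0 : 0 ≤ k₂ := by positivity
  have hk₃0 : 0 ≤ k₃ := by positivity
  refine ⟨k₂ + k₃ + 8 * ρ ^ 2, by positivity, ?_⟩
  intro m n P v e θ μ zeta lam hP he h0 h1 hμ hμρ hζ
  have hn := hP.pos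
  have hnn : (n : ℝ) ≤ n ^ 2 := by nlinarith
  have hn2 : (0 : ℝ) ≤ (n : ℝ) ^ 2 := by positivity
  set r := segment v e θ with hr
  -- Bounding below by `θe` instead of 0 keeps the point at least `θδ` while its complementarity
  -- product stays proportional to `θ`.
  obtain ⟨w, hA, hD, hwx, hwz, hc⟩ := exists_proximal P hμ (P.A *ᵥ r.x) lam (P.dualMap r) zeta
    (θ • e.x) (θ • e.z)
  have hux : ∀ i, 0 ≤ w.x i - θ * e.x i := fun i => sub_nonneg.2 (by simpa using hwx i)
  have huz : ∀ i, 0 ≤ w.z i - θ * e.z i := fun i => sub_nonneg.2 (by simpa using hwz i)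
  have hθx : ∀ i, θ * δ ≤ w.x i := fun i => by
    have := mul_le_mul_of_nonneg_left (he.x_ge i) h0
    linarith [hux i]
  have hθz : ∀ i, θ * δ ≤ w.z i := fun i => by
    have := mul_le_mul_of_nonneg_left (he.z_ge i) h0
    linarith [huz i]
  obtain ⟨hrx, hrz, hry⟩ := segment_bound hP hδ he h0 h1
  rw [← hr] at hrx hrz hry
  -- Here `w - r = (w - θe) - (1-θ)v`. The products within `w - θe` and within `v` vanish, and the
  -- cross terms are nonpositive.
  have hle : (w - r).x ⬝ᵥ (w - r).z ≤ 0 := by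
    rw [← hc]
    refine Finset.sum_le_sum fun i _ => ?_
    simp only [hr, segment, Triple.sub_x, Triple.sub_z, Triple.add_x, Triple.add_z, Triple.smul_x,
      Triple.smul_z, Pi.sub_apply, Pi.add_apply, Pi.smul_apply, smul_eq_mul]
    have h2 := mul_nonneg (mul_nonneg (sub_nonneg.2 h1) (hP.z_nonneg i)) (hux i)
    have h3 := mul_nonneg (mul_nonneg (sub_nonneg.2 h1) (hP.x_nonneg i)) (huz i)
    linear_combination h2 + h3 + (1 - θ) ^ 2 * hP.compl i
  have hS : (w - r).x ⬝ᵥ (w - r).x + (w - r).y ⬝ᵥ (w - r).y ≤ k₁ * n ^ 2 := by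
    have h2 := regularized_le P (d := w - r) hμ.le (p := lam - r.y) (q := zeta - r.x)
      (by simp only [Triple.sub_x, Triple.sub_y, Matrix.mulVec_sub]
          linear_combination (norm := module) hA)
      (by simp only [Triple.sub_x, dualMap_sub]
          linear_combination (norm := module) hD)
    -- The residuals carry the factor `μ`, so it cancels and the bound is uniform as μ tends to 0.
    have h3 : (w - r).x ⬝ᵥ (w - r).x + (w - r).y ⬝ᵥ (w - r).y
        ≤ (lam - r.y) ⬝ᵥ (lam - r.y) + (zeta - r.x) ⬝ᵥ (zeta - r.x) :=
      le_of_mul_le_mul_left (by linarith) hμ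
    have h4 := sub_dot_self_le lam r.y
    have h5 := sub_dot_self_le zeta r.x
    have h6 := mul_le_mul_of_nonneg_left hnn hk₀0
    rw [hk₁]; rw [hk₀] at h6 ⊢
    linarith
  have hdx := dot_self_nonneg (w - r).x
  have hdy := dot_self_nonneg (w - r).y
  have hζ0 := dot_self_nonneg zeta
  have hlam0 := dot_self_nonneg lam
  have hW : w.x ⬝ᵥ w.x + w.y ⬝ᵥ w.y ≤ k₂ * n ^ 2 := by
    have h2 := add_dot_self_le (w - r).x r.x
    have h3 := add_dot_self_le (w - r).y r.y
    simp only [Triple.sub_x, Triple.sub_y, sub_add_cancel] at h2 h3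
    have h6 := mul_le_mul_of_nonneg_left hnn hk₀0
    simp only [Triple.sub_x, Triple.sub_y] at hS
    rw [hk₂]; rw [hk₀] at h6 ⊢
    linarith
  have hZ : w.z ⬝ᵥ w.z ≤ k₃ * n ^ 2 := by
    have e1 : (w - r).z = (P.Q *ᵥ (w - r).x - P.Aᵀ *ᵥ (w - r).y) + μ • (w.x - zeta) := by
      have h3 : P.dualMap (w - r) = μ • (w.x - zeta) := by
        rw [dualMap_sub]; linear_combination (norm := module) hD
      simp only [Problem.dualMap] at h3
      linear_combination (norm := module) h3
    have h2 := add_dot_self_le (P.Q *ᵥ (w - r).x - P.Aᵀ *ᵥ (w - r).y) (μ • (w.x - zeta))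
    rw [← e1, smul_dot_self] at h2
    have h3 := sub_dot_self_le (P.Q *ᵥ (w - r).x) (P.Aᵀ *ᵥ (w - r).y)
    have h4 := hP.quad (w - r).x
    have h5 := hP.upper (w - r).y
    have h6 := sub_dot_self_le w.x zeta
    have h7 : μ ^ 2 * ((w.x - zeta) ⬝ᵥ (w.x - zeta)) ≤ ρ ^ 4 * (2 * (k₂ + R) * n ^ 2) := by
      refine mul_le_mul ?_ ?_ (dot_self_nonneg _) (by positivity)
      · calc μ ^ 2 ≤ (ρ ^ 2) ^ 2 := pow_le_pow_left₀ hμ.le hμρ 2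
          _ = ρ ^ 4 := by ring
      · linarith [dot_self_nonneg w.y]
    have h8 : q ^ 2 * ((w - r).x ⬝ᵥ (w - r).x) ≤ q ^ 2 * (k₁ * n ^ 2) :=
      mul_le_mul_of_nonneg_left (by linarith) (sq_nonneg q)
    have h9 : a₂ ^ 2 * ((w - r).y ⬝ᵥ (w - r).y) ≤ a₂ ^ 2 * (k₁ * n ^ 2) :=
      mul_le_mul_of_nonneg_left (by linarith) (sq_nonneg a₂)
    have h10 : w.z ⬝ᵥ w.z ≤ 2 * ((w - r).z ⬝ᵥ (w - r).z) + 2 * (r.z ⬝ᵥ r.z) := by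
      simpa using add_dot_self_le (w - r).z r.z
    have h11 := mul_le_mul_of_nonneg_left hnn hk₀0
    have h12 : 0 ≤ (2 * Cs ^ 2 + 2 * Y) * (n : ℝ) := by positivity
    rw [hk₃]; rw [hk₀] at h11 ⊢
    linarith
  have hcomp : w.x ⬝ᵥ w.z ≤ θ * ((k₂ + k₃ + 8 * ρ ^ 2) * n ^ 2) := by
    have h2 : w.x ⬝ᵥ w.z ≤ θ * (w.x ⬝ᵥ e.z + w.z ⬝ᵥ e.x) := by
      have h3 : w.x ⬝ᵥ w.z ≤ (w.x - θ • e.x) ⬝ᵥ (w.z - θ • e.z)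
          + θ * (w.x ⬝ᵥ e.z + w.z ⬝ᵥ e.x) := by
        simp only [dotProduct, ← Finset.sum_add_distrib, Finset.mul_sum]
        refine Finset.sum_le_sum fun i _ => ?_
        simp only [Pi.sub_apply, Pi.smul_apply, smul_eq_mul]
        have h4 := mul_nonneg (mul_nonneg h0 h0)
          (mul_nonneg (hδ.le.trans (he.x_ge i)) (hδ.le.trans (he.z_ge i)))
        linarith
      linarith
    refine h2.trans (mul_le_mul_of_nonneg_left ?_ h0)
    have hex : e.x ⬝ᵥ e.x ≤ (2 * ρ) ^ 2 * n := card_mul_sq fun i => by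
      rw [abs_of_nonneg (hδ.le.trans (he.x_ge i))]; exact he.x_le i
    have hez : e.z ⬝ᵥ e.z ≤ (2 * ρ) ^ 2 * n := card_mul_sq fun i => by
      rw [abs_of_nonneg (hδ.le.trans (he.z_ge i))]; exact he.z_le i
    have h5 := two_dot_le w.x e.z
    have h6 := two_dot_le w.z e.x
    have h7 := mul_le_mul_of_nonneg_left hnn (sq_nonneg (2 * ρ))
    have h8 := mul_nonneg hk₂0 hn2
    have h9 := mul_nonneg hk₃0 hn2
    linarith [dot_self_nonneg w.y, mul_nonneg (sq_nonneg ρ) hn2]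
  refine ⟨w, hA, hD, hθx, hθz, ?_, hcomp⟩
  have := mul_nonneg hk₃0 hn2
  have : 0 ≤ 8 * ρ ^ 2 * (n : ℝ) ^ 2 := by positivity
  linarith

/-- Bounds for the iterates, together with an auxiliary point solving the same equations. -/
lemma iterate_bound (hδ : 0 < δ) (hρ : 0 < ρ) (hCs : 0 ≤ Cs) (hY : 0 ≤ Y) {R : ℝ} (hR : 0 ≤ R) :
    ∃ K, 0 ≤ K ∧ ∀ (m n : ℕ) (P : Problem m n) (v e w : Triple m n) (θ μ : ℝ)
      (zeta : Fin n → ℝ) (lam : Fin m → ℝ),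
      Regular a₁ a₂ q Cs P v → Interior δ ρ Y e → 0 < θ → θ ≤ 1 → μ = θ * ρ ^ 2 →
      zeta ⬝ᵥ zeta + lam ⬝ᵥ lam ≤ R * n ^ 2 →
      (∀ i, 0 < w.x i) → (∀ i, 0 < w.z i) → w.x ⬝ᵥ w.z = n * μ →
      P.A *ᵥ w.x + μ • (w.y - lam) = P.A *ᵥ (segment v e θ).x →
      P.dualMap w - μ • (w.x - zeta) = P.dualMap (segment v e θ) →
      w.x ⬝ᵥ w.x + w.y ⬝ᵥ w.y ≤ K * n ^ 2 ∧ θ * (∑ i, w.x i + ∑ i, w.z i) ≤ K * n ^ 2 * μ ∧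
      ∃ u : Triple m n, P.A *ᵥ (w - u).x + μ • (w - u).y = 0 ∧
        P.dualMap (w - u) - μ • (w - u).x = 0 ∧ (∀ i, 0 ≤ u.x i) ∧ (∀ i, 0 ≤ u.z i) ∧
        u.x ⬝ᵥ u.x + u.y ⬝ᵥ u.y ≤ K * n ^ 2 ∧ w.x ⬝ᵥ u.z + w.z ⬝ᵥ u.x ≤ K * n ^ 2 * μ := by
  obtain ⟨k, hk0, hk⟩ := proximal_bound (a₁ := a₁) (a₂ := a₂) (q := q) hδ hρ hCs hY hR
  set k₁ := 1 + k / ρ ^ 2 with hk₁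
  have hk₁0 : 0 ≤ k₁ := by positivity
  refine ⟨2 * k₁ + 2 * k + k₁ / δ, by positivity, ?_⟩
  intro m n P v e w θ μ zeta lam hP he h0 h1 hμ hζ hx hz hxz hA hD
  have hn := hP.pos
  have hnn : (n : ℝ) ≤ n ^ 2 := by nlinarith
  have hμ0 : 0 < μ := by rw [hμ]; positivity
  have hμρ : μ ≤ ρ ^ 2 := by rw [hμ]; nlinarith [sq_nonneg ρ]
  obtain ⟨u, huA, huD, hux, huz, hub, huc⟩ := hk m n P v e θ μ zeta lam hP he h0.le h1 hμ0 hμρ hζ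
  have hθδ : 0 ≤ θ * δ := by positivity
  have d1 : P.A *ᵥ (w - u).x + μ • (w - u).y = 0 := by
    simp only [Triple.sub_x, Triple.sub_y, Matrix.mulVec_sub]
    linear_combination (norm := module) hA - huA
  have d2 : P.dualMap (w - u) - μ • (w - u).x = 0 := by
    simp only [Triple.sub_x, dualMap_sub]
    linear_combination (norm := module) hD - huD
  have h2 := regularized_homogeneous_le P d1 d2
  -- This product is at least `μ‖w - u‖²`, and the cross terms enter it with a minus sign; hence one
  -- inequality bounds both quantities.
  have h3 : (w - u).x ⬝ᵥ (w - u).z = n * μ + u.x ⬝ᵥ u.z - (w.x ⬝ᵥ u.z + w.z ⬝ᵥ u.x) := by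
    simp only [Triple.sub_x, Triple.sub_z, sub_dotProduct, dotProduct_sub, hxz,
      dotProduct_comm u.x w.z]
    ring
  have h4 : n * μ + u.x ⬝ᵥ u.z ≤ k₁ * n ^ 2 * μ := by
    have e1 : θ * (k * n ^ 2) = k / ρ ^ 2 * n ^ 2 * μ := by rw [hμ]; field_simp
    have e2 := mul_le_mul_of_nonneg_right hnn hμ0.le
    rw [hk₁]; linarith
  have hpos : 0 ≤ w.x ⬝ᵥ u.z + w.z ⬝ᵥ u.x :=
    add_nonneg (Finset.sum_nonneg fun i _ => mul_nonneg (hx i).le (hθδ.trans (huz i)))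
      (Finset.sum_nonneg fun i _ => mul_nonneg (hz i).le (hθδ.trans (hux i)))
  have hS0 := mul_nonneg hμ0.le (add_nonneg (dot_self_nonneg (w - u).x) (dot_self_nonneg (w - u).y))
  have hcross : w.x ⬝ᵥ u.z + w.z ⬝ᵥ u.x ≤ k₁ * n ^ 2 * μ := by linarith
  have hS : (w - u).x ⬝ᵥ (w - u).x + (w - u).y ⬝ᵥ (w - u).y ≤ k₁ * n ^ 2 :=
    le_of_mul_le_mul_left (by linarith) hμ0
  have hn2 : (0 : ℝ) ≤ (n : ℝ) ^ 2 := by positivity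
  have a1 := mul_nonneg hk₁0 hn2
  have a2 := mul_nonneg hk0 hn2
  have a3 := mul_nonneg (div_nonneg hk₁0 hδ.le) hn2
  refine ⟨?_, ?_, u, d1, d2, fun i => hθδ.trans (hux i), fun i => hθδ.trans (huz i), ?_, ?_⟩
  · have e1 : w.x ⬝ᵥ w.x ≤ 2 * ((w - u).x ⬝ᵥ (w - u).x) + 2 * (u.x ⬝ᵥ u.x) := by
      simpa using add_dot_self_le (w - u).x u.x
    have e2 : w.y ⬝ᵥ w.y ≤ 2 * ((w - u).y ⬝ᵥ (w - u).y) + 2 * (u.y ⬝ᵥ u.y) := by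
      simpa using add_dot_self_le (w - u).y u.y
    linarith
  · have e1 : θ * δ * (∑ i, w.x i + ∑ i, w.z i) ≤ w.x ⬝ᵥ u.z + w.z ⬝ᵥ u.x := by
      rw [mul_add, Finset.mul_sum, Finset.mul_sum]
      refine add_le_add (Finset.sum_le_sum fun i _ => ?_) (Finset.sum_le_sum fun i _ => ?_)
      · rw [mul_comm]; exact mul_le_mul_of_nonneg_left (huz i) (hx i).le
      · rw [mul_comm]; exact mul_le_mul_of_nonneg_left (hux i) (hz i).le
    have e2 : θ * (∑ i, w.x i + ∑ i, w.z i) ≤ k₁ / δ * n ^ 2 * μ := by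
      rw [div_mul_eq_mul_div, div_mul_eq_mul_div, le_div_iff₀ hδ]; linarith
    have := mul_nonneg a1 hμ0.le
    have := mul_nonneg a2 hμ0.le
    linarith
  · linarith
  · have := mul_nonneg a1 hμ0.le
    have := mul_nonneg a2 hμ0.le
    have := mul_nonneg a3 hμ0.le
    linarith

end Bounds

/-! ### The stacked norm and the semi-norm of residuals. -/

section PairNorm

variable {m n : ℕ}

lemma pairNorm_nonneg (u : Fin m → ℝ) (v : Fin n → ℝ) : 0 ≤ pairNorm u v := Real.sqrt_nonneg _

lemma pairNorm_sq (u : Fin m → ℝ) (v : Fin n → ℝ) : pairNorm u v ^ 2 = u ⬝ᵥ u + v ⬝ᵥ v :=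
  Real.sq_sqrt (add_nonneg (dot_self_nonneg u) (dot_self_nonneg v))

lemma pairNorm_le {u : Fin m → ℝ} {v : Fin n → ℝ} {a : ℝ} (ha : 0 ≤ a)
    (h : u ⬝ᵥ u + v ⬝ᵥ v ≤ a ^ 2) : pairNorm u v ≤ a :=
  Real.sqrt_le_iff.2 ⟨ha, h⟩

lemma pairNorm_smul {a : ℝ} (ha : 0 ≤ a) (u : Fin m → ℝ) (v : Fin n → ℝ) :
    pairNorm (a • u) (a • v) = a * pairNorm u v := by
  rw [pairNorm, smul_dot_self, smul_dot_self, ← mul_add, Real.sqrt_mul (sq_nonneg a),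
    Real.sqrt_sq ha, pairNorm]

lemma pairNorm_add_le (u u' : Fin m → ℝ) (v v' : Fin n → ℝ) :
    pairNorm (u + u') (v + v') ≤ pairNorm u v + pairNorm u' v' := by
  refine pairNorm_le (add_nonneg (pairNorm_nonneg _ _) (pairNorm_nonneg _ _)) ?_
  have h := le_of_abs_le (dot_le_of_sq_le (u := Sum.elim u v) (v := Sum.elim u' v')
    (pairNorm_nonneg u v) (pairNorm_nonneg u' v')
    (by rw [pairNorm_sq, sumElim_dotProduct_sumElim])
    (by rw [pairNorm_sq, sumElim_dotProduct_sumElim]))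
  rw [sumElim_dotProduct_sumElim] at h
  rw [add_sq, pairNorm_sq, pairNorm_sq]
  simp only [add_dotProduct, dotProduct_add, dotProduct_comm u' u, dotProduct_comm v' v]
  linarith

variable (P : Problem m n)

lemma seminormA_bddBelow (r : Fin m → ℝ) (s : Fin n → ℝ) :
    BddBelow {v | ∃ w : Triple m n, P.A *ᵥ w.x = r ∧ P.dualMap w = s ∧ v = pairNorm w.x w.z} :=
  ⟨0, by rintro _ ⟨w, -, -, rfl⟩; exact pairNorm_nonneg _ _⟩

lemma seminormA_le (w : Triple m n) :
    P.seminormA (P.A *ᵥ w.x) (P.dualMap w) ≤ pairNorm w.x w.z :=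
  csInf_le (seminormA_bddBelow P _ _) ⟨w, rfl, rfl, rfl⟩

variable {P} {a₁ a₂ q Cs : ℝ} {v : Triple m n}

/-- With `y = 0` the dual equation determines `z`, so a bounded right inverse of `A` suffices. -/
lemma Regular.exists_triple (hP : Regular a₁ a₂ q Cs P v) (ha₁ : 0 < a₁) (r : Fin m → ℝ)
    (s : Fin n → ℝ) : ∃ w : Triple m n, P.A *ᵥ w.x = r ∧ P.dualMap w = s ∧
      pairNorm w.x w.z ≤ √(2 + (1 + 2 * q ^ 2) / a₁ ^ 2) * pairNorm r s := by
  obtain ⟨x, hx, hxr⟩ := hP.preimage r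
  refine ⟨⟨x, 0, s + P.Q *ᵥ x⟩, hx, by simp [Problem.dualMap], ?_⟩
  refine pairNorm_le (mul_nonneg (Real.sqrt_nonneg _) (pairNorm_nonneg _ _)) ?_
  rw [mul_pow, pairNorm_sq, Real.sq_sqrt (by positivity)]
  have h1 : x ⬝ᵥ x ≤ r ⬝ᵥ r / a₁ ^ 2 := by rw [le_div_iff₀ (by positivity)]; linarith
  have h2 := add_dot_self_le s (P.Q *ᵥ x)
  have h3 := hP.quad x
  have h4 : (1 + 2 * q ^ 2) * (x ⬝ᵥ x) ≤ (1 + 2 * q ^ 2) * (r ⬝ᵥ r / a₁ ^ 2) :=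
    mul_le_mul_of_nonneg_left h1 (by positivity)
  have h5 : 0 ≤ (1 + 2 * q ^ 2) / a₁ ^ 2 * (s ⬝ᵥ s) :=
    mul_nonneg (by positivity) (dot_self_nonneg s)
  have h6 : (1 + 2 * q ^ 2) * (r ⬝ᵥ r / a₁ ^ 2) = (1 + 2 * q ^ 2) / a₁ ^ 2 * (r ⬝ᵥ r) := by ring
  dsimp only
  linarith [dot_self_nonneg r]

lemma Regular.exists_lt_of_seminormA_lt (hP : Regular a₁ a₂ q Cs P v) (ha₁ : 0 < a₁)
    {r : Fin m → ℝ} {s : Fin n → ℝ} {a : ℝ} (h : P.seminormA r s < a) :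
    ∃ w : Triple m n, P.A *ᵥ w.x = r ∧ P.dualMap w = s ∧ pairNorm w.x w.z < a := by
  obtain ⟨w₀, h1, h2, -⟩ := hP.exists_triple ha₁ r s
  obtain ⟨_, ⟨w, hw1, hw2, rfl⟩, hw⟩ := exists_lt_of_csInf_lt (s :=
    {v | ∃ w : Triple m n, P.A *ᵥ w.x = r ∧ P.dualMap w = s ∧ v = pairNorm w.x w.z})
    ⟨_, w₀, h1, h2, rfl⟩ h
  exact ⟨w, hw1, hw2, hw⟩

/-- Near-minimisers of the first term are combined with an explicit triple for the second. The
Euclidean norm in the last term is the quantity controlled for the second-order error of a step. -/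
lemma Regular.seminormA_smul_add_le (hP : Regular a₁ a₂ q Cs P v) (ha₁ : 0 < a₁)
    (r r' : Fin m → ℝ) (s s' : Fin n → ℝ) {a : ℝ} (ha : 0 ≤ a) :
    P.seminormA (a • r + r') (a • s + s') ≤
      a * P.seminormA r s + √(2 + (1 + 2 * q ^ 2) / a₁ ^ 2) * pairNorm r' s' := by
  obtain ⟨w', h1, h2, h3⟩ := hP.exists_triple ha₁ r' s'
  have key : ∀ ε > 0, P.seminormA (a • r + r') (a • s + s') ≤
      a * (P.seminormA r s + ε) + √(2 + (1 + 2 * q ^ 2) / a₁ ^ 2) * pairNorm r' s' := by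
    intro ε hε
    obtain ⟨w, hw1, hw2, hw⟩ := hP.exists_lt_of_seminormA_lt ha₁
      (show P.seminormA r s < P.seminormA r s + ε by linarith)
    have h4 := seminormA_le P (a • w + w')
    rw [dualMap_add, dualMap_smul, Triple.add_x, Matrix.mulVec_add, Triple.smul_x,
      Matrix.mulVec_smul, hw1, hw2, h1, h2] at h4
    have h5 := pairNorm_add_le (a • w.x) w'.x (a • w.z) w'.z
    rw [pairNorm_smul ha] at h5
    have h6 := mul_le_mul_of_nonneg_left hw.le ha
    exact h4.trans (by simpa using h5.trans (by linarith))
  refine le_of_forall_pos_le_add fun ε hε => ?_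
  have := key (ε / (a + 1)) (div_pos hε (by linarith))
  have h7 : a * (ε / (a + 1)) ≤ ε := by
    rw [mul_div_assoc', div_le_iff₀ (by linarith)]; nlinarith
  linarith

/-- Admissible perturbations are realised by small triples. -/
lemma Regular.exists_shift (hP : Regular a₁ a₂ q Cs P v) (ha₁ : 0 < a₁) {r : Fin m → ℝ}
    {s : Fin n → ℝ} {CN a a' : ℝ} (hr : pairNorm r s ≤ CN)
    (hs : P.seminormA r s ≤ a) (haa : a < a') :
    ∃ w : Triple m n, P.A *ᵥ w.x = r ∧ P.dualMap w = s ∧ (∀ i, |w.x i| ≤ a') ∧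
      (∀ i, |w.z i| ≤ a') ∧
      w.y ⬝ᵥ w.y ≤ (2 * CN ^ 2 + 4 * q ^ 2 * a' ^ 2 + 4 * a' ^ 2) / a₁ ^ 2 := by
  obtain ⟨w, h1, h2, h3⟩ := hP.exists_lt_of_seminormA_lt ha₁ (hs.trans_lt haa)
  have ha' : 0 ≤ a' := (pairNorm_nonneg _ _).trans h3.le
  have h4 : w.x ⬝ᵥ w.x + w.z ⬝ᵥ w.z ≤ a' ^ 2 := by
    rw [← pairNorm_sq]; exact pow_le_pow_left₀ (pairNorm_nonneg _ _) h3.le 2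
  have h5 : r ⬝ᵥ r + s ⬝ᵥ s ≤ CN ^ 2 := by
    rw [← pairNorm_sq]; exact pow_le_pow_left₀ (pairNorm_nonneg _ _) hr 2
  have hx0 := dot_self_nonneg w.x
  have hz0 := dot_self_nonneg w.z
  refine ⟨w, h1, h2, fun i => abs_le_of_sq_le_sq ?_ ha', fun i => abs_le_of_sq_le_sq ?_ ha', ?_⟩
  · linarith [sq_apply_le_dot_self w.x i]
  · linarith [sq_apply_le_dot_self w.z i]
  · rw [le_div_iff₀ (by positivity)]
    have h6 : P.Aᵀ *ᵥ w.y = s + (P.Q *ᵥ w.x - w.z) := by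
      rw [← h2, Problem.dualMap]; abel
    have h7 := hP.lower w.y
    rw [h6] at h7
    have h8 := add_dot_self_le s (P.Q *ᵥ w.x - w.z)
    have h9 := sub_dot_self_le (P.Q *ᵥ w.x) w.z
    have h10 := hP.quad w.x
    have h11 : q ^ 2 * (w.x ⬝ᵥ w.x) ≤ q ^ 2 * a' ^ 2 :=
      mul_le_mul_of_nonneg_left (by linarith) (sq_nonneg q)
    linarith [dot_self_nonneg r]

end PairNorm

/-! ### Size of the Newton direction. -/

section Direction

/-- Componentwise estimate behind the bound on the Newton direction. -/
lemma abs_mul_le_of_scaled {x z D E a c T : ℝ} (hx : 0 < x) (hz : 0 < z) (ha : |z * a| ≤ T)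
    (hc : |x * c| ≤ T) (hV : |z * D + x * E| ≤ T) :
    |(D - a) * (E - c)| ≤ 3 * (T ^ 2 / (x * z)) - 2 * (D * E) ∧
      2 * (D * E) ≤ T ^ 2 / (x * z) := by
  have hxz : 0 < x * z := mul_pos hx hz
  have h1 : (z * D + x * E) ^ 2 ≤ T ^ 2 := sq_le_sq' (abs_le.1 hV).1 (abs_le.1 hV).2
  have h2 : (z * a) ^ 2 ≤ T ^ 2 := sq_le_sq' (abs_le.1 ha).1 (abs_le.1 ha).2
  have h3 : (x * c) ^ 2 ≤ T ^ 2 := sq_le_sq' (abs_le.1 hc).1 (abs_le.1 hc).2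
  have e1 : 2 * (D * E) * (x * z) ≤ T ^ 2 := by
    nlinarith [sq_nonneg (z * D), sq_nonneg (x * E)]
  refine ⟨?_, (le_div_iff₀ hxz).2 e1⟩
  -- This uses `(zD)² + (xE)² = (zD + xE)² - 2xzDE`. The term `DE` is kept because only its sum over
  -- the components is controlled from below, by monotonicity.
  have e2 : (|(D - a) * (E - c)| + 2 * (D * E)) * (x * z) ≤ 3 * T ^ 2 := by
    have e3 : |(D - a) * (E - c)| * (x * z) = |(z * (D - a)) * (x * (E - c))| := by
      rw [show (z * (D - a)) * (x * (E - c)) = (D - a) * (E - c) * (x * z) by ring,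
        abs_mul _ (x * z), abs_of_pos hxz]
    rw [add_mul, e3]
    have e4 : |(z * (D - a)) * (x * (E - c))|
        ≤ ((z * (D - a)) ^ 2 + (x * (E - c)) ^ 2) / 2 := by
      rw [abs_le]; constructor <;>
        nlinarith [sq_nonneg (z * (D - a) + x * (E - c)), sq_nonneg (z * (D - a) - x * (E - c))]
    nlinarith [sq_nonneg (z * D + z * a), sq_nonneg (x * E + x * c)]
  rw [← mul_div_assoc, le_sub_iff_add_le, le_div_iff₀ hxz]
  exact e2

variable {a₁ a₂ q Cs δ ρ Y : ℝ}

lemma abs_shift_le {θ σ a b c : ℝ} (h0 : 0 ≤ θ) (hσ0 : 0 ≤ σ) (hσ1 : σ ≤ 1) (ha : 0 ≤ a)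
    (ha' : a ≤ 2 * ρ) (hb : 0 ≤ b) (hb' : b ≤ Cs) (hc : 0 ≤ c) (hc' : c ≤ 2 * ρ) :
    |θ * ((1 - σ) * (a - b) + (c - a))| ≤ θ * (6 * ρ + Cs) := by
  rw [abs_mul, abs_of_nonneg h0]
  refine mul_le_mul_of_nonneg_left ?_ h0
  have h1 := mul_nonneg (sub_nonneg.2 hσ1) ha
  have h2 := mul_nonneg (sub_nonneg.2 hσ1) hb
  have h3 := mul_nonneg hσ0 ha
  have h4 := mul_nonneg hσ0 hb
  rw [abs_le]
  constructor <;> linarith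

set_option maxHeartbeats 1000000 in
/-- Bounds for the Newton direction at an iterate of the neighbourhood. -/
lemma direction_bound (hδ : 0 < δ) (hρ : 0 < ρ) (hCs : 0 ≤ Cs) (hY : 0 ≤ Y) {R γ : ℝ}
    (hR : 0 ≤ R) (hγ : 0 < γ) :
    ∃ K, 0 ≤ K ∧ ∀ (m n : ℕ) (P : Problem m n) (v e w₀ w d : Triple m n) (θ μ σ : ℝ)
      (zeta : Fin n → ℝ) (lam : Fin m → ℝ),
      Regular a₁ a₂ q Cs P v → Interior δ ρ Y e → Interior δ ρ Y w₀ →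
      0 < θ → θ ≤ 1 → μ = θ * ρ ^ 2 → 0 ≤ σ → σ ≤ 1 →
      zeta ⬝ᵥ zeta + lam ⬝ᵥ lam ≤ R * n ^ 2 →
      (∀ i, 0 < w.x i) → (∀ i, 0 < w.z i) → w.x ⬝ᵥ w.z = n * μ →
      (∀ i, γ * μ ≤ w.x i * w.z i) →
      P.A *ᵥ w.x + μ • (w.y - lam) = P.A *ᵥ (segment v e θ).x →
      P.dualMap w - μ • (w.x - zeta) = P.dualMap (segment v e θ) →
      P.A *ᵥ d.x + μ • d.y = -(P.A *ᵥ w.x + (σ * μ) • (w.y - lam)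
        - (P.b + (σ * θ) • (P.A *ᵥ w₀.x - P.b))) →
      P.dualMap d - μ • d.x = -(-(P.c + (σ * θ) • (P.dualMap w₀ - P.c)) + P.dualMap w
        - (σ * μ) • (w.x - zeta)) →
      (∀ i, w.z i * d.x i + w.x i * d.z i = -(w.x i * w.z i - σ * μ)) →
      (∀ i, |d.x i * d.z i| ≤ K * n ^ 4 * μ) ∧ |d.x ⬝ᵥ d.z| ≤ K * n ^ 4 * μ ∧
        d.x ⬝ᵥ d.x + d.y ⬝ᵥ d.y ≤ K * n ^ 4 ∧ w.x ⬝ᵥ w.x + w.y ⬝ᵥ w.y ≤ K * n ^ 2 := by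
  obtain ⟨k, hk0, hk⟩ := iterate_bound (a₁ := a₁) (a₂ := a₂) (q := q) hδ hρ hCs hY hR
  set G := 6 * ρ + Cs with hG
  set H := 12 * Y + 4 * Cs ^ 2 with hH
  have hG0 : 0 ≤ G := by positivity
  have hH0 : 0 ≤ H := by positivity
  set k₃ := 2 + k + G * k with hk₃
  set k₄ := 4 * k + 4 * R + 2 * (H + G ^ 2) with hk₄
  have hk₃0 : 0 ≤ k₃ := by positivity
  have hk₄0 : 0 ≤ k₄ := by positivity
  refine ⟨3 * (k₃ ^ 2 / γ) + k₄ + (2 * (k₃ ^ 2 / γ + k₄) + 4 * (4 * k) + 4 * (G ^ 2 + H)) + k,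
    by positivity, ?_⟩
  intro m n P v e w₀ w d θ μ σ zeta lam hP he hw₀ h0 h1 hμ hσ0 hσ1 hζ hx hz hxz hγxz hA hD hdA hdD
    hdC
  obtain ⟨hwb, hws, u, d1, d2, hux, huz, hub, huc⟩ :=
    hk m n P v e w θ μ zeta lam hP he h0 h1 hμ hζ hx hz hxz hA hD
  have hn := hP.pos
  have hμ0 : 0 < μ := by rw [hμ]; positivity
  have hn2 : (1 : ℝ) ≤ (n : ℝ) ^ 2 := by nlinarith
  have hnn : (n : ℝ) ≤ n ^ 2 := by nlinarith
  have hn4 : (n : ℝ) ^ 2 ≤ n ^ 4 := by nlinarith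
  -- The constraint maps send `g` to the gap between the current right-hand sides, of parameter `θ`
  -- with perturbation, and the Newton targets, of parameter `σθ` without it.
  set g : Triple m n := θ • ((1 - σ) • (w₀ - v) + (e - w₀)) with hg
  have hgx : ∀ i, |g.x i| ≤ θ * G := fun i => by
    simpa [hg] using abs_shift_le h0.le hσ0 hσ1 (hδ.le.trans (hw₀.x_ge i)) (hw₀.x_le i) (hP.x_nonneg i)
      (hP.x_le i) (hδ.le.trans (he.x_ge i)) (he.x_le i)
  have hgz : ∀ i, |g.z i| ≤ θ * G := fun i => by
    simpa [hg] using abs_shift_le h0.le hσ0 hσ1 (hδ.le.trans (hw₀.z_ge i)) (hw₀.z_le i) (hP.z_nonneg i)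
      (hP.z_le i) (hδ.le.trans (he.z_ge i)) (he.z_le i)
  have hgxx : g.x ⬝ᵥ g.x ≤ G ^ 2 * n := card_mul_sq fun i => (hgx i).trans (by nlinarith)
  have hgyy : g.y ⬝ᵥ g.y ≤ H * n := by
    have e1 : g.y ⬝ᵥ g.y = θ ^ 2 * (((1 - σ) • (w₀.y - v.y) + (e.y - w₀.y)) ⬝ᵥ
        ((1 - σ) • (w₀.y - v.y) + (e.y - w₀.y))) := by
      simp only [hg, Triple.smul_y, Triple.add_y, Triple.sub_y, smul_dot_self]
    have e2 := add_dot_self_le ((1 - σ) • (w₀.y - v.y)) (e.y - w₀.y)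
    rw [smul_dot_self] at e2
    have e3 := sub_dot_self_le w₀.y v.y
    have e4 := sub_dot_self_le e.y w₀.y
    have e5 : (1 - σ) ^ 2 * ((w₀.y - v.y) ⬝ᵥ (w₀.y - v.y)) ≤ (w₀.y - v.y) ⬝ᵥ (w₀.y - v.y) :=
      mul_le_of_le_one_left (dot_self_nonneg _) (by nlinarith)
    have e6 := mul_le_of_le_one_left (dot_self_nonneg ((1 - σ) • (w₀.y - v.y) + (e.y - w₀.y)))
      (show θ ^ 2 ≤ 1 by nlinarith)
    have := he.y_sq
    have := hw₀.y_sq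
    have := hP.y_sq
    rw [e1, hH]; linarith
  -- Adding `g` cancels the infeasibility and `w - u` solves the homogeneous equations, so the
  -- remaining residuals are `μ` times the bounded vectors `p` and `-r`.
  set D : Triple m n := d + (w - u) + g with hDdef
  set p : Fin m → ℝ := (1 - σ) • (w.y - lam) + g.y with hp
  set r : Fin n → ℝ := (1 - σ) • (w.x - zeta) + g.x with hr
  have hD1 : P.A *ᵥ D.x + μ • D.y = μ • p := by
    have e1 : P.A *ᵥ g.x = θ • ((1 - σ) • (P.A *ᵥ w₀.x - P.b) + (P.A *ᵥ e.x - P.A *ᵥ w₀.x)) := by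
      simp only [hg, Triple.smul_x, Triple.add_x, Triple.sub_x, Matrix.mulVec_smul,
        Matrix.mulVec_add, Matrix.mulVec_sub, hP.primal]
    have e2 : P.A *ᵥ (segment v e θ).x = (1 - θ) • P.b + θ • P.A *ᵥ e.x := by
      simp only [segment, Triple.smul_x, Triple.add_x, Matrix.mulVec_smul, Matrix.mulVec_add,
        hP.primal]
    simp only [hDdef, hp, Triple.add_x, Triple.add_y, Matrix.mulVec_add, e1]
    rw [e2] at hA
    linear_combination (norm := module) hdA + d1 - hA
  have hD2 : P.dualMap D - μ • D.x = -(μ • r) := by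
    have e1 : P.dualMap g = θ • ((1 - σ) • (P.dualMap w₀ - P.c)
        + (P.dualMap e - P.dualMap w₀)) := by
      simp only [hg, dualMap_smul, dualMap_add, dualMap_sub, hP.dual]
    have e2 : P.dualMap (segment v e θ) = (1 - θ) • P.c + θ • P.dualMap e := by
      simp only [segment, dualMap_smul, dualMap_add, hP.dual]
    simp only [hDdef, hr, Triple.add_x, dualMap_add, e1]
    rw [e2] at hD
    linear_combination (norm := module) hdD + d2 - hD
  have hreg := regularized_le P hμ0.le hD1 hD2
  have hPQ : p ⬝ᵥ p + r ⬝ᵥ r ≤ k₄ * n ^ 2 := by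
    have e1 := add_dot_self_le ((1 - σ) • (w.y - lam)) g.y
    have e2 := add_dot_self_le ((1 - σ) • (w.x - zeta)) g.x
    rw [smul_dot_self] at e1 e2
    have e3 := sub_dot_self_le w.y lam
    have e4 := sub_dot_self_le w.x zeta
    have hs : (1 - σ) ^ 2 ≤ 1 := by nlinarith
    have e5 := mul_le_of_le_one_left (dot_self_nonneg (w.y - lam)) hs
    have e6 := mul_le_of_le_one_left (dot_self_nonneg (w.x - zeta)) hs
    have e7 := mul_le_mul_of_nonneg_left hnn (add_nonneg hH0 (sq_nonneg G))
    rw [hk₄]; simp only [hp, hr]; linarith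
  -- One majorant for the complementarity residual of `D` and for the scaled components of the
  -- correction `w - u + g`.
  set T : Fin n → ℝ := fun i => w.x i * w.z i + μ + w.z i * u.x i + w.x i * u.z i
    + G * (θ * (w.x i + w.z i)) with hT
  have hT0 : ∀ i, 0 ≤ T i := fun i => by
    have := hx i; have := hz i; have := hux i; have := huz i
    simp only [hT]; positivity
  have hTsum : ∑ i, T i ≤ k₃ * n ^ 2 * μ := by
    have e1 : ∑ i, T i = w.x ⬝ᵥ w.z + n * μ + w.z ⬝ᵥ u.x + w.x ⬝ᵥ u.z
        + G * (θ * (∑ i, w.x i + ∑ i, w.z i)) := by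
      simp only [hT, dotProduct, Finset.sum_add_distrib, ← Finset.mul_sum, Finset.sum_const,
        Finset.card_univ, Fintype.card_fin, nsmul_eq_mul]
    have e2 := mul_le_mul_of_nonneg_left hws hG0
    have e3 := mul_le_mul_of_nonneg_right hnn hμ0.le
    rw [e1, hk₃, hxz]; linarith
  -- The total `∑ T = O(n²μ)` is squared and divided by `γμ`; this is the source of the power `n⁴`.
  set τ := k₃ ^ 2 / γ * n ^ 4 * μ with hτ
  have hTτ : ∑ i, T i ^ 2 / (w.x i * w.z i) ≤ τ := by
    have hγμ : 0 < γ * μ := mul_pos hγ hμ0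
    calc ∑ i, T i ^ 2 / (w.x i * w.z i) ≤ ∑ i, T i ^ 2 / (γ * μ) :=
          Finset.sum_le_sum fun i _ => div_le_div_of_nonneg_left (sq_nonneg _) hγμ (hγxz i)
      _ = (∑ i, T i ^ 2) / (γ * μ) := by rw [Finset.sum_div]
      _ ≤ (k₃ * n ^ 2 * μ) ^ 2 / (γ * μ) := by
          refine div_le_div_of_nonneg_right ?_ hγμ.le
          refine (Finset.sum_sq_le_sq_sum_of_nonneg fun i _ => hT0 i).trans ?_
          exact pow_le_pow_left₀ (Finset.sum_nonneg fun i _ => hT0 i) hTsum 2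
      _ = τ := by rw [hτ]; field_simp
  have hcomp : ∀ i, |d.x i * d.z i| ≤ 3 * (T i ^ 2 / (w.x i * w.z i)) - 2 * (D.x i * D.z i) ∧
      2 * (D.x i * D.z i) ≤ T i ^ 2 / (w.x i * w.z i) := by
    intro i
    have hxi := hx i; have hzi := hz i; have huxi := hux i; have huzi := huz i
    have p1 := mul_pos hxi hzi
    have p2 := mul_nonneg hzi.le huxi
    have p3 := mul_nonneg hxi.le huzi
    have p4 : 0 ≤ G * (θ * w.x i) := by positivity
    have p5 : 0 ≤ G * (θ * w.z i) := by positivity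
    have hσμ : 0 ≤ σ * μ ∧ σ * μ ≤ μ := ⟨mul_nonneg hσ0 hμ0.le, mul_le_of_le_one_left hμ0.le hσ1⟩
    obtain ⟨q1, q2⟩ := abs_le.1 (hgx i)
    obtain ⟨q3, q4⟩ := abs_le.1 (hgz i)
    have r1 := mul_le_mul_of_nonneg_left q1 hzi.le
    have r2 := mul_le_mul_of_nonneg_left q2 hzi.le
    have r3 := mul_le_mul_of_nonneg_left q3 hxi.le
    have r4 := mul_le_mul_of_nonneg_left q4 hxi.le
    have hdx : d.x i = D.x i - (w.x i - u.x i + g.x i) := by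
      simp [hDdef]
    have hdz : d.z i = D.z i - (w.z i - u.z i + g.z i) := by
      simp [hDdef]
    have hdCi := hdC i
    rw [hdx, hdz] at hdCi ⊢
    refine abs_mul_le_of_scaled hxi hzi ?_ ?_ ?_
    · rw [abs_le]; simp only [hT]; constructor <;> linarith
    · rw [abs_le]; simp only [hT]; constructor <;> linarith
    · rw [abs_le]; simp only [hT]; constructor <;> linarith
  have hsumabs : ∑ i, |d.x i * d.z i| ≤ 3 * τ - 2 * (D.x ⬝ᵥ D.z) := by
    refine (Finset.sum_le_sum fun i _ => (hcomp i).1).trans ?_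
    rw [Finset.sum_sub_distrib, ← Finset.mul_sum, ← Finset.mul_sum]
    exact sub_le_sub_right (mul_le_mul_of_nonneg_left hTτ (by norm_num)) _
  have hDD : 2 * (D.x ⬝ᵥ D.z) ≤ τ := by
    refine le_trans ?_ hTτ
    rw [dotProduct, Finset.mul_sum]
    exact Finset.sum_le_sum fun i _ => (hcomp i).2
  have hS0 : 0 ≤ μ * (D.x ⬝ᵥ D.x + D.y ⬝ᵥ D.y) :=
    mul_nonneg hμ0.le (add_nonneg (dot_self_nonneg _) (dot_self_nonneg _))
  have hPQμ : μ * (p ⬝ᵥ p + r ⬝ᵥ r) ≤ k₄ * n ^ 4 * μ := by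
    have e1 := mul_le_mul_of_nonneg_left hPQ hμ0.le
    have e2 := mul_le_mul_of_nonneg_left (mul_le_mul_of_nonneg_left hn4 hk₄0) hμ0.le
    linarith
  have hn40 : (0 : ℝ) ≤ (n : ℝ) ^ 4 := by positivity
  have hsum' : ∑ i, |d.x i * d.z i| ≤ (3 * (k₃ ^ 2 / γ) + k₄) * n ^ 4 * μ := by
    rw [hτ] at hsumabs; linarith
  have hrest : 0 ≤ ((2 * (k₃ ^ 2 / γ + k₄) + 4 * (4 * k) + 4 * (G ^ 2 + H)) + k) * n ^ 4 := by
    positivity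
  have hsum : ∑ i, |d.x i * d.z i| ≤ (3 * (k₃ ^ 2 / γ) + k₄ + (2 * (k₃ ^ 2 / γ + k₄) + 4 * (4 * k)
      + 4 * (G ^ 2 + H)) + k) * n ^ 4 * μ := by
    have := mul_nonneg hrest hμ0.le
    linarith
  have hfirst : 0 ≤ (3 * (k₃ ^ 2 / γ) + k₄) * (n : ℝ) ^ 4 := by positivity
  refine ⟨fun i => ?_, ?_, ?_, ?_⟩
  · exact (Finset.single_le_sum (f := fun i => |d.x i * d.z i|) (fun j _ => abs_nonneg _)
      (Finset.mem_univ i)).trans hsum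
  · exact (Finset.abs_sum_le_sum_abs _ _).trans hsum
  · have hDb : D.x ⬝ᵥ D.x + D.y ⬝ᵥ D.y ≤ (k₃ ^ 2 / γ + k₄) * n ^ 4 := by
      refine le_of_mul_le_mul_left ?_ hμ0
      rw [hτ] at hDD; linarith
    have hdx : d.x = D.x - ((w.x - u.x) + g.x) := by
      simp only [hDdef, Triple.add_x, Triple.sub_x]; abel
    have hdy : d.y = D.y - ((w.y - u.y) + g.y) := by
      simp only [hDdef, Triple.add_y, Triple.sub_y]; abel
    have e1 := sub_dot_self_le D.x ((w.x - u.x) + g.x)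
    have e2 := sub_dot_self_le D.y ((w.y - u.y) + g.y)
    rw [← hdx] at e1
    rw [← hdy] at e2
    have e3 := add_dot_self_le (w.x - u.x) g.x
    have e4 := add_dot_self_le (w.y - u.y) g.y
    have e5 := sub_dot_self_le w.x u.x
    have e6 := sub_dot_self_le w.y u.y
    have e7 := mul_le_mul_of_nonneg_left (hnn.trans hn4) (add_nonneg (sq_nonneg G) hH0)
    have e8 := mul_le_mul_of_nonneg_left hn4 hk0
    have e9 : 0 ≤ k * (n : ℝ) ^ 4 := by positivity
    linarith
  · have e1 : 0 ≤ (3 * (k₃ ^ 2 / γ) + k₄ + (2 * (k₃ ^ 2 / γ + k₄) + 4 * (4 * k)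
      + 4 * (G ^ 2 + H))) * (n : ℝ) ^ 2 := by positivity
    linarith

end Direction

/-! ### Unique solvability of the Newton system. -/

section Newton

variable {m n : ℕ}

lemma mu0_eq (hn : 0 < n) (ρ : ℝ) (y₀ : Fin m → ℝ) : mu0 (n := n) ρ y₀ = ρ ^ 2 := by
  have : (n : ℝ) ≠ 0 := by positivity
  simp [mu0, Triple.mu, startTriple, dotProduct]
  field_simp

lemma dot_eq_mu (hn : 0 < n) (w : Triple m n) : w.x ⬝ᵥ w.z = n * w.mu := by
  have : (n : ℝ) ≠ 0 := by positivity
  rw [Triple.mu]; field_simp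

/-- The matrix of the Newton system. -/
def newtonMap (P : Problem m n) (w : Triple m n) (μ : ℝ) :
    ((Fin n → ℝ) × (Fin m → ℝ) × (Fin n → ℝ)) →ₗ[ℝ]
      ((Fin n → ℝ) × (Fin m → ℝ) × (Fin n → ℝ)) where
  toFun d := (P.dualMap ⟨d.1, d.2.1, d.2.2⟩ - μ • d.1, P.A *ᵥ d.1 + μ • d.2.1,
    w.z * d.1 + w.x * d.2.2)
  map_add' d d' := by
    have := dualMap_add P ⟨d.1, d.2.1, d.2.2⟩ ⟨d'.1, d'.2.1, d'.2.2⟩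
    refine Prod.ext ?_ (Prod.ext ?_ ?_)
    · refine (congrArg (· - μ • (d.1 + d'.1)) this).trans ?_
      simp only [Prod.fst_add]; module
    · simp only [Prod.fst_add, Prod.snd_add, Matrix.mulVec_add]; module
    · simp only [Prod.fst_add, Prod.snd_add]; ring
  map_smul' a d := by
    have := dualMap_smul P a ⟨d.1, d.2.1, d.2.2⟩
    refine Prod.ext ?_ (Prod.ext ?_ ?_)
    · refine (congrArg (· - μ • (a • d.1)) this).trans ?_
      simp only [Prod.smul_fst, RingHom.id_apply]; module
    · simp only [Prod.smul_fst, Prod.smul_snd, Matrix.mulVec_smul, RingHom.id_apply]; module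
    · simp only [Prod.smul_fst, Prod.smul_snd, RingHom.id_apply, mul_smul_comm, smul_add]

/-- In the kernel the complementarity rows give `dxᵀdz ≤ 0`, while monotonicity gives `dxᵀdz ≥
μ(‖dx‖² + ‖dy‖²)`. -/
lemma newtonMap_injective (P : Problem m n) {w : Triple m n} {μ : ℝ} (hμ : 0 < μ)
    (hx : ∀ i, 0 < w.x i) (hz : ∀ i, 0 < w.z i) : Function.Injective (newtonMap P w μ) := by
  rw [← LinearMap.ker_eq_bot, LinearMap.ker_eq_bot']
  rintro ⟨dx, dy, dz⟩ h
  simp only [newtonMap, LinearMap.coe_mk, AddHom.coe_mk, Prod.mk_eq_zero] at h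
  obtain ⟨h1, h2, h3⟩ := h
  have h4 := regularized_homogeneous_le P (d := ⟨dx, dy, dz⟩) h2 h1
  have hi : ∀ i, w.z i * dx i + w.x i * dz i = 0 := fun i => congrFun h3 i
  have h5 : dx ⬝ᵥ dz ≤ 0 := Finset.sum_nonpos fun i _ => by
    have e : w.x i * (dx i * dz i) = -(w.z i * dx i ^ 2) := by
      linear_combination dx i * hi i
    have : w.x i * (dx i * dz i) ≤ 0 := by
      rw [e]; have := mul_nonneg (hz i).le (sq_nonneg (dx i)); linarith
    exact nonpos_of_mul_nonpos_right this (hx i)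
  have h6 : dx ⬝ᵥ dx + dy ⬝ᵥ dy ≤ 0 := nonpos_of_mul_nonpos_right (h4.trans h5) hμ
  have hdx : dx = 0 := dotProduct_self_eq_zero.1
    (le_antisymm (by linarith [dot_self_nonneg dy]) (dot_self_nonneg dx))
  have hdy : dy = 0 := dotProduct_self_eq_zero.1
    (le_antisymm (by linarith [dot_self_nonneg dx]) (dot_self_nonneg dy))
  have hdz : dz = 0 := by
    ext i
    have := hi i
    simp only [hdx, Pi.zero_apply, mul_zero, zero_add, mul_eq_zero, (hx i).ne', false_or] at this
    exact this
  simp [hdx, hdy, hdz]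

lemma existsUnique_newton (P : Problem m n) (ρ : ℝ) (y₀ : Fin m → ℝ) {s : State m n} (σ : ℝ)
    (hμ : 0 < s.w.mu) (hx : ∀ i, 0 < s.w.x i) (hz : ∀ i, 0 < s.w.z i) :
    ∃! d, IsNewton P ρ y₀ s σ d := by
  have hinj := newtonMap_injective P hμ hx hz
  have hsurj := LinearMap.injective_iff_surjective.1 hinj
  have key : ∀ d : Triple m n, IsNewton P ρ y₀ s σ d ↔
      newtonMap P s.w s.w.mu (d.x, d.y, d.z) =
        (-(-(P.c + (σ * s.w.mu / mu0 (n := n) ρ y₀) • cbar P ρ y₀) + P.dualMap s.w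
          - (σ * s.w.mu) • (s.w.x - s.zeta)),
        -(P.A *ᵥ s.w.x + (σ * s.w.mu) • (s.w.y - s.lam)
          - (P.b + (σ * s.w.mu / mu0 (n := n) ρ y₀) • bbar P ρ y₀)),
        fun i => -(s.w.x i * s.w.z i - σ * s.w.mu)) := by
    intro d
    simp only [IsNewton, newtonMap, LinearMap.coe_mk, AddHom.coe_mk, Prod.mk.injEq, funext_iff,
      Pi.add_apply, Pi.mul_apply]
  obtain ⟨d, hd⟩ := hsurj (-(-(P.c + (σ * s.w.mu / mu0 (n := n) ρ y₀) • cbar P ρ y₀)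
      + P.dualMap s.w - (σ * s.w.mu) • (s.w.x - s.zeta)),
    -(P.A *ᵥ s.w.x + (σ * s.w.mu) • (s.w.y - s.lam)
      - (P.b + (σ * s.w.mu / mu0 (n := n) ρ y₀) • bbar P ρ y₀)),
    fun i => -(s.w.x i * s.w.z i - σ * s.w.mu))
  refine ⟨⟨d.1, d.2.1, d.2.2⟩, (key _).2 hd, fun d' hd' => ?_⟩
  have := hinj (((key d').1 hd').trans hd.symm)
  rw [← this]

end Newton

/-! ### A uniform acceptable step-length. -/

section StepLength

lemma exists_small (c₁ c₂ c₃ c₄ B₁ B₂ B₃ B₄ : ℝ) (h₁ : 0 < c₁) (h₂ : 0 < c₂) (h₃ : 0 < c₃)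
    (h₄ : 0 < c₄) (hB₁ : 0 ≤ B₁) (hB₂ : 0 ≤ B₂) (hB₃ : 0 ≤ B₃) (hB₄ : 0 ≤ B₄) :
    ∃ κ : ℝ, 0 < κ ∧ κ ≤ 1 ∧ κ * B₁ ≤ c₁ ∧ κ * B₂ ≤ c₂ ∧ κ * B₃ ≤ c₃ ∧ κ * B₄ ≤ c₄ := by
  have aux : ∀ {κ c B : ℝ}, 0 < c → 0 ≤ B → κ ≤ c / (B + 1) → κ * B ≤ c := fun hc hB h =>
    (mul_le_mul_of_nonneg_right h hB).trans (by
      rw [div_mul_eq_mul_div, div_le_iff₀ (by linarith)]; nlinarith)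
  refine ⟨min 1 (min (min (c₁ / (B₁ + 1)) (c₂ / (B₂ + 1))) (min (c₃ / (B₃ + 1)) (c₄ / (B₄ + 1)))),
    by positivity, min_le_left _ _, aux h₁ hB₁ ?_, aux h₂ hB₂ ?_, aux h₃ hB₃ ?_, aux h₄ hB₄ ?_⟩
  · exact (min_le_right _ _).trans ((min_le_left _ _).trans (min_le_left _ _))
  · exact (min_le_right _ _).trans ((min_le_left _ _).trans (min_le_right _ _))
  · exact (min_le_right _ _).trans ((min_le_right _ _).trans (min_le_left _ _))
  · exact (min_le_right _ _).trans ((min_le_right _ _).trans (min_le_right _ _))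

/-- The perturbation caused by a step is of second order in the step-length. -/
lemma residual_bound {m n : ℕ} {K ρ μ t s : ℝ} (hK : 0 ≤ K) (hμ : 0 ≤ μ) (hn : 1 ≤ (n : ℝ))
    {b y dy : Fin m → ℝ} {c x dx : Fin n → ℝ} (ht : |t| ≤ K * n ^ 3 * μ)
    (hs : |s| ≤ (1 + K) * μ) (hbc : b ⬝ᵥ b + c ⬝ᵥ c ≤ K * n ^ 2)
    (hxy : x ⬝ᵥ x + y ⬝ᵥ y ≤ K * n ^ 2) (hd : dx ⬝ᵥ dx + dy ⬝ᵥ dy ≤ K * n ^ 4) :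
    pairNorm (-(t / ρ ^ 2) • b + t • y + s • dy) (-(t / ρ ^ 2) • c - t • x - s • dx)
      ≤ √(4 * K ^ 3 * (1 / ρ ^ 4 + 1) + 2 * (1 + K) ^ 2 * K) * (n ^ 4 * μ) := by
  refine pairNorm_le (by positivity) ?_
  rw [mul_pow, Real.sq_sqrt (by positivity)]
  have e1 := add_dot_self_le (-(t / ρ ^ 2) • b + t • y) (s • dy)
  have e2 := add_dot_self_le (-(t / ρ ^ 2) • b) (t • y)
  have e3 := sub_dot_self_le (-(t / ρ ^ 2) • c - t • x) (s • dx)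
  have e4 := sub_dot_self_le (-(t / ρ ^ 2) • c) (t • x)
  rw [smul_dot_self] at e1 e3
  rw [smul_dot_self, smul_dot_self] at e2 e4
  have ht2 : t ^ 2 ≤ (K * n ^ 3 * μ) ^ 2 := sq_le_sq' (abs_le.1 ht).1 (abs_le.1 ht).2
  have hs2 : s ^ 2 ≤ ((1 + K) * μ) ^ 2 := sq_le_sq' (abs_le.1 hs).1 (abs_le.1 hs).2
  have f1 : t ^ 2 * (b ⬝ᵥ b + c ⬝ᵥ c) ≤ (K * n ^ 3 * μ) ^ 2 * (K * n ^ 2) :=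
    mul_le_mul ht2 hbc (add_nonneg (dot_self_nonneg _) (dot_self_nonneg _)) (sq_nonneg _)
  have f2 : t ^ 2 * (x ⬝ᵥ x + y ⬝ᵥ y) ≤ (K * n ^ 3 * μ) ^ 2 * (K * n ^ 2) :=
    mul_le_mul ht2 hxy (add_nonneg (dot_self_nonneg _) (dot_self_nonneg _)) (sq_nonneg _)
  have f3 : s ^ 2 * (dx ⬝ᵥ dx + dy ⬝ᵥ dy) ≤ ((1 + K) * μ) ^ 2 * (K * n ^ 4) :=
    mul_le_mul hs2 hd (add_nonneg (dot_self_nonneg _) (dot_self_nonneg _)) (sq_nonneg _)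
  have f4 : ((1 + K) * μ) ^ 2 * (K * n ^ 4) ≤ ((1 + K) * μ) ^ 2 * (K * n ^ 8) := by
    gcongr
    norm_num
  have f5 := mul_le_mul_of_nonneg_left f1 (show 0 ≤ 1 / ρ ^ 4 by positivity)
  have f6 : (-(t / ρ ^ 2)) ^ 2 = 1 / ρ ^ 4 * t ^ 2 := by rw [neg_sq, div_pow, ← pow_mul]; ring
  rw [f6] at e2 e4
  linarith

variable {a₁ a₂ q Cs : ℝ}

set_option maxHeartbeats 1000000 in
/-- All sufficiently small step-lengths are acceptable, uniformly in the problem. -/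
lemma exists_acceptable (par : Params) {ρ : ℝ} (hρ : 0 < ρ) (ha₁ : 0 < a₁) {K : ℝ} (hK : 0 ≤ K) :
    ∃ κ : ℝ, 0 < κ ∧ κ ≤ 1 ∧ ∀ (m n : ℕ) (P : Problem m n) (v : Triple m n) (y₀ : Fin m → ℝ)
      (s : State m n) (σ : ℝ) (d : Triple m n),
      0 < n → Regular a₁ a₂ q Cs P v → 0 < s.w.mu →
      s.w ∈ neighbourhood par P ρ y₀ s.w.mu s.zeta s.lam → par.σmin ≤ σ → σ ≤ par.σmax →
      IsNewton P ρ y₀ s σ d →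
      (∀ i, |d.x i * d.z i| ≤ K * n ^ 4 * s.w.mu) → |d.x ⬝ᵥ d.z| ≤ K * n ^ 4 * s.w.mu →
      d.x ⬝ᵥ d.x + d.y ⬝ᵥ d.y ≤ K * n ^ 4 →
      (s.w.x - s.zeta) ⬝ᵥ (s.w.x - s.zeta) + (s.w.y - s.lam) ⬝ᵥ (s.w.y - s.lam) ≤ K * n ^ 2 →
      bbar P ρ y₀ ⬝ᵥ bbar P ρ y₀ + cbar P ρ y₀ ⬝ᵥ cbar P ρ y₀ ≤ K * n ^ 2 →
      ∀ α, 0 < α → α ≤ κ / n ^ 4 → α ∈ acceptable par P ρ y₀ s d := by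
  set B := √(4 * K ^ 3 * (1 / ρ ^ 4 + 1) + 2 * (1 + K) ^ 2 * K) with hB
  set H := √(2 + (1 + 2 * q ^ 2) / a₁ ^ 2) with hH
  have hB0 : 0 ≤ B := Real.sqrt_nonneg _
  have hH0 : 0 ≤ H := Real.sqrt_nonneg _
  have hCN := par.CN_pos
  have hγA := par.γA_pos
  have hγ := par.γμ_pos
  have hγ1 := par.γμ_lt
  have hσm := par.σmin_pos
  have hγρ : 0 < par.γA * ρ := mul_pos hγA hρ
  -- The four constraints serve the decrease of μ (0.49 = 1/2 - 0.01, with σ ≤ 1/2), centrality, and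
  -- the Euclidean and semi-norm bounds on the perturbation.
  obtain ⟨κ, hκ0, hκ1, hκa, hκb, hκc, hκd⟩ := exists_small 0.49 (par.σmin * (1 - par.γμ))
    (par.CN * par.σmin) (par.γA * ρ * par.σmin) K (2 * K) (B * ρ ^ 2 + par.CN * K)
    (H * B * ρ ^ 2 + par.γA * ρ * K) (by norm_num) (mul_pos hσm (by linarith)) (mul_pos hCN hσm)
    (mul_pos hγρ hσm) hK (by positivity) (by positivity) (by positivity)
  refine ⟨κ, hκ0, hκ1, ?_⟩
  intro m n P v y₀ s σ d hn hP hμ hs hσ0 hσ1 hN hdi hdd hdxy hxy hbc α hα hακ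
  obtain ⟨⟨btil, ctil, hA, hD, hpn, hsn⟩, hx, hz, hxz⟩ := hs
  obtain ⟨hdD, hdA, hdC⟩ := hN
  rw [mu0_eq hn] at hA hD hdD hdA
  set μ := s.w.mu with hμdef
  have hn1 := hP.pos
  have hnpos : (0 : ℝ) < n := by linarith
  have hn4 : (1 : ℝ) ≤ (n : ℝ) ^ 4 := one_le_pow₀ hn1
  have hσ : σ ≤ 1 / 2 := hσ1.trans par.σmax_le
  have hσp : 0 < σ := hσm.trans_le hσ0
  have hαN : α * n ^ 4 ≤ κ := (le_div_iff₀ (by positivity)).1 hακ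
  have hα1 : α ≤ 1 := by nlinarith
  set t := d.x ⬝ᵥ d.z / n with ht
  have htb : |t| ≤ K * n ^ 3 * μ := by
    rw [ht, abs_div, abs_of_pos hnpos, div_le_iff₀ hnpos]
    refine hdd.trans (le_of_eq (by ring))
  have hsmall : ∀ r, |r| ≤ K * n ^ 4 * μ → |α * r| ≤ κ * K * μ := by
    intro r hr
    rw [abs_mul, abs_of_pos hα]
    calc α * |r| ≤ α * (K * n ^ 4 * μ) := mul_le_mul_of_nonneg_left hr hα.le
      _ = α * n ^ 4 * (K * μ) := by ring
      _ ≤ κ * (K * μ) := mul_le_mul_of_nonneg_right hαN (by positivity)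
      _ = κ * K * μ := by ring
  have hαt : |α * t| ≤ κ * K * μ := by
    refine hsmall t (htb.trans ?_)
    have h3 : (n : ℝ) ^ 3 ≤ n ^ 4 := pow_le_pow_right₀ hn1 (by norm_num)
    gcongr
  obtain ⟨hαt1, hαt2⟩ := abs_le.1 hαt
  set μ' := (s.w.move α d).mu with hμ'
  have hμ'eq : μ' = (1 - α * (1 - σ)) * μ + α ^ 2 * t := by
    have h1 : s.w.z ⬝ᵥ d.x + s.w.x ⬝ᵥ d.z = -(s.w.x ⬝ᵥ s.w.z - n * (σ * μ)) := by
      have h2 : ∑ i, (s.w.z i * d.x i + s.w.x i * d.z i)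
          = ∑ i, -(s.w.x i * s.w.z i - σ * μ) := Finset.sum_congr rfl fun i _ => hdC i
      simpa [dotProduct, Finset.sum_add_distrib, Finset.sum_sub_distrib] using h2
    have h3 := dot_eq_mu hn s.w
    have h4 : μ' * n = (s.w.x + α • d.x) ⬝ᵥ (s.w.z + α • d.z) := by
      rw [hμ', Triple.mu, Triple.move, div_mul_cancel₀ _ hnpos.ne']
    have h5 : t * n = d.x ⬝ᵥ d.z := by rw [ht, div_mul_cancel₀ _ hnpos.ne']
    simp only [add_dotProduct, dotProduct_add, smul_dotProduct, dotProduct_smul, smul_eq_mul,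
      dotProduct_comm d.x s.w.z] at h4
    refine mul_right_cancel₀ hnpos.ne' ?_
    rw [h3] at h1 h4
    linear_combination h4 + α * h1 - α ^ 2 * h5
  have hαμ : 0 < α * μ := mul_pos hα hμ
  have hα2t : |α ^ 2 * t| ≤ α * (κ * K * μ) := by
    rw [show α ^ 2 * t = α * (α * t) by ring, abs_mul, abs_of_pos hα]
    exact mul_le_mul_of_nonneg_left hαt hα.le
  obtain ⟨hα2t1, hα2t2⟩ := abs_le.1 hα2t
  have hκσ : κ * (2 * K) * (α * μ) ≤ σ * (1 - par.γμ) * (α * μ) :=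
    mul_le_mul_of_nonneg_right
      (hκb.trans (mul_le_mul_of_nonneg_right hσ0 (by linarith))) hαμ.le
  have hσαμ : 0 < σ * (α * μ) := mul_pos hσp hαμ
  have hγσαμ : 0 < par.γμ * (σ * (α * μ)) := mul_pos hγ hσαμ
  have h1αμ : 0 ≤ (1 - α) * μ := mul_nonneg (by linarith) hμ.le
  have hμ'pos : 0 < μ' := by
    rw [hμ'eq]
    linarith
  have hmu : μ' ≤ (1 - 0.01 * α) * μ := by
    rw [hμ'eq]
    have h1 := mul_le_mul_of_nonneg_right hκa hαμ.le
    have h2 := mul_le_mul_of_nonneg_right hσ hαμ.le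
    norm_num at h1 ⊢
    linarith
  have hprod : ∀ i, par.γμ * μ' ≤ (s.w.x i + α * d.x i) * (s.w.z i + α * d.z i) := by
    intro i
    have h1 : |α * (d.x i * d.z i)| ≤ κ * K * μ := hsmall _ (hdi i)
    have h2 := mul_le_mul_of_nonneg_left (abs_le.1 h1).1 hα.le
    have h3 : (s.w.x i + α * d.x i) * (s.w.z i + α * d.z i)
        = (1 - α) * (s.w.x i * s.w.z i) + α * (σ * μ) + α * (α * (d.x i * d.z i)) := by
      linear_combination α * hdC i
    have h4 := mul_le_mul_of_nonneg_left (hxz i) (show 0 ≤ 1 - α by linarith)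
    have h5 := mul_le_mul_of_nonneg_left hα2t2 hγ.le
    have h6 : par.γμ * (α * (κ * K * μ)) ≤ 1 * (α * (κ * K * μ)) :=
      mul_le_mul_of_nonneg_right hγ1.le (by positivity)
    rw [h3, hμ'eq]
    linarith
  -- The product is positive, and both factors cannot be negative because the complementarity row
  -- makes a positive combination of them positive.
  have hpos : ∀ i, 0 < s.w.x i + α * d.x i ∧ 0 < s.w.z i + α * d.z i := by
    intro i
    have h1 : 0 < (s.w.x i + α * d.x i) * (s.w.z i + α * d.z i) :=
      (mul_pos hγ hμ'pos).trans_le (hprod i)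
    rcases pos_and_pos_or_neg_and_neg_of_mul_pos h1 with h | ⟨h2, h3⟩
    · exact h
    · exfalso
      have h4 := mul_neg_of_pos_of_neg (hz i) h2
      have h5 := mul_neg_of_pos_of_neg (hx i) h3
      have h6 : s.w.z i * (s.w.x i + α * d.x i) + s.w.x i * (s.w.z i + α * d.z i)
          = (2 - α) * (s.w.x i * s.w.z i) + α * (σ * μ) := by
        linear_combination α * hdC i
      have h7 : 0 < (2 - α) * (s.w.x i * s.w.z i) :=
        mul_pos (by linarith) (mul_pos (hx i) (hz i))
      have h8 : 0 < α * (σ * μ) := by positivity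
      linarith
  set θ := μ / ρ ^ 2 with hθ
  have hρ2 : 0 < ρ ^ 2 := by positivity
  have hθ0 : 0 < θ := div_pos hμ hρ2
  have hθμ : μ = θ * ρ ^ 2 := by rw [hθ, div_mul_cancel₀ _ hρ2.ne']
  set θ' := μ' / ρ ^ 2 with hθ'
  have hθ'0 : 0 < θ' := div_pos hμ'pos hρ2
  have hθ'eq : θ' = (1 - α * (1 - σ)) * θ + α ^ 2 * (t / ρ ^ 2) := by
    rw [hθ', hμ'eq, hθ]; ring
  -- The old perturbation shrinks by `1 - α` while `θ` shrinks only by `1 - α(1-σ)` to first order;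
  -- the difference `ασθ` pays for the second-order terms.
  have hbudget : ∀ c B' : ℝ, 0 < c → 0 ≤ B' → κ * (B' * ρ ^ 2 + c * K) ≤ c * par.σmin →
      (1 - α) * θ * c + α ^ 2 * (B' * (n ^ 4 * μ)) ≤ c * θ' := by
    intro c B' hc hB' h
    have h1 : α ^ 2 * (B' * (n ^ 4 * μ)) ≤ α * (κ * (B' * ρ ^ 2) * θ) := by
      have := mul_le_mul_of_nonneg_right hαN (show 0 ≤ α * (B' * μ) by positivity)
      rw [hθμ] at this ⊢
      linarith
    have h2 : -(α * (κ * K * θ)) ≤ α ^ 2 * (t / ρ ^ 2) := by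
      have h3 : α ^ 2 * (t / ρ ^ 2) = α ^ 2 * t / ρ ^ 2 := by ring
      rw [h3, le_div_iff₀ hρ2]
      rw [hθμ] at hα2t1
      linarith
    have h3 := mul_le_mul_of_nonneg_left h2 hc.le
    have h4 := mul_le_mul_of_nonneg_right h (mul_pos hα hθ0).le
    have h5 := mul_le_mul_of_nonneg_right (mul_le_mul_of_nonneg_left hσ0 hc.le)
      (mul_pos hα hθ0).le
    rw [hθ'eq]
    linarith
  -- This is `(μ' - μ)/α`. The vectors `Eb` and `Ec` below collect the `α²` terms of the regularized
  -- equations at the new point.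
  set u := α * t - (1 - σ) * μ with hu
  have hub : |u| ≤ (1 + K) * μ := by
    have h1 : κ * K * μ ≤ K * μ := by
      have := mul_le_mul_of_nonneg_right hκ1 (mul_nonneg hK hμ.le); linarith
    have h2 : 0 ≤ σ * μ := by positivity
    have h3 := mul_le_mul_of_nonneg_right hσ hμ.le
    have h4 := mul_nonneg hK hμ.le
    rw [abs_le, hu]
    constructor <;> linarith
  set Eb := -(t / ρ ^ 2) • bbar P ρ y₀ + t • (s.w.y - s.lam) + u • d.y with hEb
  set Ec := -(t / ρ ^ 2) • cbar P ρ y₀ - t • (s.w.x - s.zeta) - u • d.x with hEc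
  have hE : pairNorm Eb Ec ≤ B * (n ^ 4 * μ) :=
    residual_bound hK hμ.le hn1 htb hub hbc hxy hdxy
  have hinv : 0 ≤ θ'⁻¹ := (inv_pos.2 hθ'0).le
  have h1αθ : 0 ≤ (1 - α) * θ := mul_nonneg (by linarith) hθ0.le
  -- The equations are linear up to the `α²` terms, so the new perturbation, rescaled by `θ'`, is
  -- the old one damped by `1 - α` plus `α²` times the error.
  refine ⟨hα, hα1, hmu, ⟨θ'⁻¹ • (((1 - α) * θ) • btil + α ^ 2 • Eb),
    θ'⁻¹ • (((1 - α) * θ) • ctil + α ^ 2 • Ec), ?_, ?_, ?_, ?_⟩, fun i => (hpos i).1,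
    fun i => (hpos i).2, hprod⟩
  · rw [mu0_eq hn, ← hμ', ← hθ', smul_add, smul_smul, mul_inv_cancel₀ hθ'0.ne', one_smul, hμ'eq,
      hθ'eq]
    simp only [Triple.move, Matrix.mulVec_add, Matrix.mulVec_smul, hEb, hu]
    rw [mul_div_assoc, ← hθ] at hdA
    linear_combination (norm := module) (1 - α) • hA + α • hdA
  · rw [mu0_eq hn, ← hμ', ← hθ', smul_add, smul_smul, mul_inv_cancel₀ hθ'0.ne', one_smul, hμ'eq,
      hθ'eq]
    have hmv : P.dualMap (s.w.move α d) = P.dualMap s.w + α • P.dualMap d := by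
      rw [← dualMap_smul, ← dualMap_add]; rfl
    rw [hmv]
    simp only [Triple.move, hEc, hu]
    rw [mul_div_assoc, ← hθ] at hdD
    linear_combination (norm := module) (1 - α) • hD + α • hdD
  · rw [pairNorm_smul hinv, inv_mul_le_iff₀ hθ'0]
    refine (pairNorm_add_le _ _ _ _).trans ?_
    rw [pairNorm_smul h1αθ, pairNorm_smul (sq_nonneg α)]
    have h1 := mul_le_mul_of_nonneg_left hpn h1αθ
    have h2 := mul_le_mul_of_nonneg_left hE (sq_nonneg α)
    linarith [hbudget par.CN B hCN hB0 hκc]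
  · clear_value Eb Ec
    have h0 := hP.seminormA_smul_add_le ha₁ btil ((θ'⁻¹ * α ^ 2) • Eb) ctil ((θ'⁻¹ * α ^ 2) • Ec)
      (mul_nonneg hinv h1αθ)
    rw [smul_add, smul_add, smul_smul, smul_smul, smul_smul, smul_smul]
    refine h0.trans ?_
    rw [pairNorm_smul (mul_nonneg hinv (sq_nonneg α)), ← hH]
    have h1 := mul_le_mul_of_nonneg_left hsn h1αθ
    have h2 := mul_le_mul_of_nonneg_left (mul_le_mul_of_nonneg_left hE hH0) (sq_nonneg α)
    have h3 := hbudget (par.γA * ρ) (H * B) hγρ (mul_nonneg hH0 hB0) hκd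
    rw [show θ'⁻¹ * ((1 - α) * θ) * P.seminormA btil ctil
        + H * (θ'⁻¹ * α ^ 2 * pairNorm Eb Ec)
      = θ'⁻¹ * ((1 - α) * θ * P.seminormA btil ctil + α ^ 2 * (H * pairNorm Eb Ec)) by ring,
      inv_mul_le_iff₀ hθ'0]
    linarith

end StepLength

/-! ### The invariant of the iteration and the decrease of μ. -/

section Convergence

variable {m n : ℕ}

lemma exists_regular {P : Problem m n} {Cs CA₁ CA₂ CQ Cr : ℝ} (hn : 0 < n) (hCA₁ : 0 < CA₁)
    (hCA₂ : 0 < CA₂) (hopt : P.BoundedOptimum Cs) (hdata : P.BoundedData CA₁ CA₂ CQ Cr) :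
    ∃ v, Regular CA₁ CA₂ CQ Cs P v := by
  obtain ⟨v, hv, hx, hy, hz⟩ := hopt
  obtain ⟨hrank, hs1, hs2, hq, -, -⟩ := hdata
  have hpre := exists_preimage_of_singularValues hCA₁.le hrank hs1
  have hup := mulVec_dot_self_le_of_singularValues hCA₂.le hrank hs2
  have hmn : (m : ℝ) ≤ n := by exact_mod_cast hrank ▸ P.A.rank_le_width
  have hxz := hv.complementary
  have hterm := (Finset.sum_eq_zero_iff_of_nonneg fun i _ =>
    mul_nonneg (hv.1.1.2 i) (hv.2.1.2 i)).1 hxz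
  have hyy : v.y ⬝ᵥ v.y ≤ Cs ^ 2 * m := card_mul_sq fun i => (norm_le_pi_norm v.y i).trans hy
  exact ⟨v, {
    pos := by exact_mod_cast hn
    le := hmn
    preimage := hpre
    lower := le_transpose_mulVec_dot_self hpre
    upper := transpose_mulVec_dot_self_le hup
    upper' := hup
    quad := posSemidef_mulVec_dot_self_le P.psd hq
    primal := hv.1.1.1
    dual := hv.2.1.1
    x_nonneg := hv.1.1.2
    x_le := fun i => (le_abs_self _).trans ((norm_le_pi_norm v.x i).trans hx)
    z_nonneg := hv.2.1.2
    z_le := fun i => (le_abs_self _).trans ((norm_le_pi_norm v.z i).trans hz)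
    compl := fun i => hterm i (Finset.mem_univ i)
    y_sq := hyy.trans (mul_le_mul_of_nonneg_left hmn (sq_nonneg _)) }⟩

lemma interior_start {P : Problem m n} {a₁ a₂ q Cs ρ δ Y Cy : ℝ} {v : Triple m n}
    (hP : Regular a₁ a₂ q Cs P v) (hρ : 0 < ρ) (hδ : δ ≤ ρ) (hY : Cy ^ 2 ≤ Y) {y₀ : Fin m → ℝ}
    (hy : ‖y₀‖ ≤ Cy) : Interior δ ρ Y (startTriple n ρ y₀) where
  x_ge _ := hδ
  x_le _ := by simp only [startTriple]; linarith
  z_ge _ := hδ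
  z_le _ := by simp only [startTriple]; linarith
  y_sq := by
    have h1 : y₀ ⬝ᵥ y₀ ≤ Cy ^ 2 * m := card_mul_sq fun i => (norm_le_pi_norm y₀ i).trans hy
    have h2 := mul_le_mul_of_nonneg_left hP.le (sq_nonneg Cy)
    have h3 := mul_le_mul_of_nonneg_right hY (zero_le_one.trans hP.pos)
    exact h1.trans (h2.trans h3)

/-- The perturbed right-hand sides of the neighbourhood are attained on a segment from the
reference solution to an interior triple. -/
lemma exists_interior {P : Problem m n} {a₁ a₂ q Cs ρ Cy CN γ : ℝ} {v : Triple m n}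
    (hP : Regular a₁ a₂ q Cs P v) (ha₁ : 0 < a₁) (hρ : 0 < ρ) (hγ : γ < 1)
    {y₀ : Fin m → ℝ} (hy : ‖y₀‖ ≤ Cy) {btil : Fin m → ℝ} {ctil : Fin n → ℝ}
    (hp : pairNorm btil ctil ≤ CN) (hs : P.seminormA btil ctil ≤ γ * ρ) :
    ∃ e, Interior ((1 - γ) / 2 * ρ) ρ (2 * Cy ^ 2 +
        2 * ((2 * CN ^ 2 + 4 * q ^ 2 * ((1 + γ) / 2 * ρ) ^ 2 + 4 * ((1 + γ) / 2 * ρ) ^ 2) / a₁ ^ 2)) e ∧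
      ∀ θ : ℝ, P.b + θ • (bbar P ρ y₀ + btil) = P.A *ᵥ (segment v e θ).x ∧
        P.c + θ • (cbar P ρ y₀ + ctil) = P.dualMap (segment v e θ) := by
  -- The midpoint of `γρ` and `ρ`: it exceeds the semi-norm bound strictly, so no minimiser is
  -- needed, and the shifted start stays at least `ρ - a' = (1-γ)ρ/2`.
  set a' := (1 + γ) / 2 * ρ with ha'
  obtain ⟨w, hw1, hw2, hwx, hwz, hwy⟩ :=
    hP.exists_shift ha₁ hp hs (a' := a') (by rw [ha']; nlinarith)
  have hle : a' ≤ ρ := by rw [ha']; nlinarith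
  set k := (2 * CN ^ 2 + 4 * q ^ 2 * a' ^ 2 + 4 * a' ^ 2) / a₁ ^ 2 with hk
  have hk0 : 0 ≤ k := by positivity
  refine ⟨startTriple n ρ y₀ + w, ⟨fun i => ?_, fun i => ?_, fun i => ?_, fun i => ?_, ?_⟩,
    fun θ => ⟨?_, ?_⟩⟩
  · have := (abs_le.1 (hwx i)).1
    simp only [Triple.add_x, Pi.add_apply, startTriple]; linarith
  · have := (abs_le.1 (hwx i)).2
    simp only [Triple.add_x, Pi.add_apply, startTriple]; linarith
  · have := (abs_le.1 (hwz i)).1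
    simp only [Triple.add_z, Pi.add_apply, startTriple]; linarith
  · have := (abs_le.1 (hwz i)).2
    simp only [Triple.add_z, Pi.add_apply, startTriple]; linarith
  · have h1 := (interior_start hP hρ le_rfl le_rfl hy).y_sq
    have h2 := add_dot_self_le (startTriple n ρ y₀).y w.y
    have h3 := mul_le_mul_of_nonneg_left hP.pos hk0
    simp only [Triple.add_y]
    linarith
  · simp only [segment, bbar, Triple.add_x, Triple.smul_x, Matrix.mulVec_add, Matrix.mulVec_smul,
      hP.primal, hw1]
    module
  · simp only [segment, cbar, dualMap_add, dualMap_smul, hP.dual, hw2]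
    module

lemma initial_residual_bound {P : Problem m n} {a₁ a₂ q Cs ρ Cy : ℝ} {v : Triple m n}
    (hP : Regular a₁ a₂ q Cs P v) (hρ : 0 < ρ) {y₀ : Fin m → ℝ} (hy : ‖y₀‖ ≤ Cy) :
    bbar P ρ y₀ ⬝ᵥ bbar P ρ y₀ + cbar P ρ y₀ ⬝ᵥ cbar P ρ y₀ ≤
      ((a₂ ^ 2 + 4 * q ^ 2 + 2) * (ρ + Cs) ^ 2 + 8 * a₂ ^ 2 * (Cy ^ 2 + Cs ^ 2)) * n ^ 2 := by
  set d := startTriple n ρ y₀ - v with hd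
  have hb : bbar P ρ y₀ = P.A *ᵥ d.x := by
    simp only [bbar, hd, Triple.sub_x, Matrix.mulVec_sub, hP.primal]
  have hc : cbar P ρ y₀ = (P.Aᵀ *ᵥ d.y - P.Q *ᵥ d.x) + d.z := by
    have : cbar P ρ y₀ = P.dualMap d := by simp only [cbar, hd, dualMap_sub, hP.dual]
    rw [this, Problem.dualMap]; abel
  have hdx : d.x ⬝ᵥ d.x ≤ (ρ + Cs) ^ 2 * n := card_mul_sq fun i => by
    have h1 := hP.x_nonneg i
    have h2 := hP.x_le i
    simp only [hd, Triple.sub_x, startTriple, Pi.sub_apply]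
    rw [abs_le]; constructor <;> linarith
  have hdz : d.z ⬝ᵥ d.z ≤ (ρ + Cs) ^ 2 * n := card_mul_sq fun i => by
    have h1 := hP.z_nonneg i
    have h2 := hP.z_le i
    simp only [hd, Triple.sub_z, startTriple, Pi.sub_apply]
    rw [abs_le]; constructor <;> linarith
  have hdy : d.y ⬝ᵥ d.y ≤ 2 * (Cy ^ 2 + Cs ^ 2) * n := by
    have h1 := (interior_start hP hρ le_rfl le_rfl hy).y_sq
    have h2 := sub_dot_self_le (startTriple n ρ y₀).y v.y
    have h3 := hP.y_sq
    simp only [hd, Triple.sub_y]; linarith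
  have h1 := hP.upper' d.x
  have h2 := add_dot_self_le (P.Aᵀ *ᵥ d.y - P.Q *ᵥ d.x) d.z
  have h3 := sub_dot_self_le (P.Aᵀ *ᵥ d.y) (P.Q *ᵥ d.x)
  have h4 := hP.upper d.y
  have h5 := hP.quad d.x
  have h6 := mul_le_mul_of_nonneg_left hdx (sq_nonneg a₂)
  have h7 := mul_le_mul_of_nonneg_left hdx (sq_nonneg q)
  have h8 := mul_le_mul_of_nonneg_left hdy (sq_nonneg a₂)
  have h9 : (n : ℝ) ≤ n ^ 2 := by nlinarith [hP.pos]
  have h10 := mul_le_mul_of_nonneg_left h9 (show 0 ≤ (a₂ ^ 2 + 4 * q ^ 2 + 2) * (ρ + Cs) ^ 2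
    + 8 * a₂ ^ 2 * (Cy ^ 2 + Cs ^ 2) by positivity)
  rw [hb, hc]
  linarith

/-- The equations and bounds, without regularization, that the proximal estimates satisfy. -/
def Perturbed (par : Params) (P : Problem m n) (ρ : ℝ) (y₀ : Fin m → ℝ) (w : Triple m n) : Prop :=
  ∃ (btil : Fin m → ℝ) (ctil : Fin n → ℝ),
    P.A *ᵥ w.x = P.b + (w.mu / mu0 (n := n) ρ y₀) • (bbar P ρ y₀ + btil) ∧
    P.dualMap w = P.c + (w.mu / mu0 (n := n) ρ y₀) • (cbar P ρ y₀ + ctil) ∧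
    pairNorm btil ctil ≤ par.CN ∧ P.seminormA btil ctil ≤ par.γA * ρ

/-- The properties of all the states that the algorithm reaches. -/
structure Invariant (par : Params) (P : Problem m n) (ρ : ℝ) (y₀ : Fin m → ℝ) (s : State m n) :
    Prop where
  mem : s.w ∈ neighbourhood par P ρ y₀ s.w.mu s.zeta s.lam
  mu_pos : 0 < s.w.mu
  mu_le : s.w.mu ≤ ρ ^ 2
  -- Here `u` is the last iterate that passed the update test, or the start; its unregularized
  -- equations are what bounds the proximal estimates.
  center : ∃ u : Triple m n, u.x = s.zeta ∧ u.y = s.lam ∧ 0 < u.mu ∧ u.mu ≤ ρ ^ 2 ∧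
    (∀ i, 0 < u.x i) ∧ (∀ i, 0 < u.z i) ∧ Perturbed par P ρ y₀ u

lemma Perturbed.mem_neighbourhood {par : Params} {P : Problem m n} {ρ : ℝ} {y₀ : Fin m → ℝ}
    {w : Triple m n} (h : Perturbed par P ρ y₀ w) (hx : ∀ i, 0 < w.x i) (hz : ∀ i, 0 < w.z i)
    (hxz : ∀ i, par.γμ * w.mu ≤ w.x i * w.z i) :
    w ∈ neighbourhood par P ρ y₀ w.mu w.x w.y := by
  obtain ⟨b, c, h1, h2, h3, h4⟩ := h
  exact ⟨⟨b, c, by simpa using h1, by simpa using h2, h3, h4⟩, hx, hz, hxz⟩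

lemma pairNorm_zero : pairNorm (0 : Fin m → ℝ) (0 : Fin n → ℝ) = 0 := by simp [pairNorm]

lemma invariant_start (par : Params) (P : Problem m n) {ρ : ℝ} (hρ : 0 < ρ) (hn : 0 < n)
    (y₀ : Fin m → ℝ) : Invariant par P ρ y₀ (startState n ρ y₀) := by
  have hmu : (startTriple n ρ y₀).mu = ρ ^ 2 := mu0_eq hn ρ y₀
  have hρ2 : 0 < ρ ^ 2 := by positivity
  have hpert : Perturbed par P ρ y₀ (startTriple n ρ y₀) := by
    refine ⟨0, 0, ?_, ?_, ?_, ?_⟩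
    · rw [hmu, mu0_eq hn, div_self hρ2.ne', bbar]; simp
    · rw [hmu, mu0_eq hn, div_self hρ2.ne', cbar]; simp
    · rw [pairNorm_zero]; exact par.CN_pos.le
    · have h1 := seminormA_le P (⟨0, 0, 0⟩ : Triple m n)
      simp only [Problem.dualMap, Matrix.mulVec_zero, neg_zero, add_zero, pairNorm_zero] at h1
      exact h1.trans (mul_pos par.γA_pos hρ).le
  refine ⟨?_, ?_, ?_, startTriple n ρ y₀, rfl, rfl, ?_, ?_, fun _ => hρ, fun _ => hρ, hpert⟩
  · refine hpert.mem_neighbourhood (fun _ => hρ) (fun _ => hρ) fun i => ?_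
    rw [hmu]
    simp only [startTriple]
    nlinarith [par.γμ_lt]
  all_goals simp only [startState, hmu]
  all_goals first | exact hρ2 | exact le_rfl

lemma perturbed_of_updateTest {par : Params} {P : Problem m n} {a₁ a₂ q Cs ρ : ℝ}
    {v : Triple m n} (hP : Regular a₁ a₂ q Cs P v) (ha₁ : 0 < a₁) {y₀ : Fin m → ℝ}
    {w : Triple m n} (hθ : 0 < w.mu / mu0 (n := n) ρ y₀) (h : updateTest par P ρ y₀ w) :
    Perturbed par P ρ y₀ w := by
  obtain ⟨h1, h2⟩ := h
  set θ := w.mu / mu0 (n := n) ρ y₀ with hθdef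
  set rp := P.A *ᵥ w.x - (P.b + θ • bbar P ρ y₀) with hrp
  set rd := P.dualMap w - (P.c + θ • cbar P ρ y₀) with hrd
  have hinv : 0 ≤ θ⁻¹ := (inv_pos.2 hθ).le
  refine ⟨θ⁻¹ • rp, θ⁻¹ • rd, ?_, ?_, ?_, ?_⟩
  · rw [← hθdef, smul_add, smul_smul, mul_inv_cancel₀ hθ.ne', hrp]; module
  · rw [← hθdef, smul_add, smul_smul, mul_inv_cancel₀ hθ.ne', hrd]; module
  · rw [pairNorm_smul hinv, inv_mul_le_iff₀ hθ]; linarith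
  · have h3 := hP.seminormA_smul_add_le ha₁ rp 0 rd 0 hinv
    rw [pairNorm_zero, mul_zero, add_zero, add_zero, add_zero] at h3
    refine h3.trans ?_
    rw [inv_mul_le_iff₀ hθ]; linarith

/-- A step-length of order `n⁻⁴` is acceptable at every state that satisfies the invariant. -/
lemma exists_uniform_step (par : Params) {ρ Cs CA₁ CA₂ CQ Cy : ℝ} (hρ : 0 < ρ) (hCs : 0 ≤ Cs)
    (hCA₁ : 0 < CA₁) :
    ∃ κ : ℝ, 0 < κ ∧ κ ≤ 1 ∧ ∀ (m n : ℕ) (P : Problem m n) (v : Triple m n) (y₀ : Fin m → ℝ)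
      (s : State m n) (σ : ℝ) (d : Triple m n), 0 < n → ‖y₀‖ ≤ Cy →
      Regular CA₁ CA₂ CQ Cs P v → Invariant par P ρ y₀ s → par.σmin ≤ σ → σ ≤ par.σmax →
      IsNewton P ρ y₀ s σ d → κ / n ^ 4 ∈ acceptable par P ρ y₀ s d := by
  have hγ0 := par.γA_pos
  have hγ1 := par.γA_lt
  set δ := (1 - par.γA) / 2 * ρ with hδ
  set Y := 2 * Cy ^ 2 + 2 * ((2 * par.CN ^ 2 + 4 * CQ ^ 2 * ((1 + par.γA) / 2 * ρ) ^ 2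
    + 4 * ((1 + par.γA) / 2 * ρ) ^ 2) / CA₁ ^ 2) with hY
  have hδ0 : 0 < δ := mul_pos (by linarith) hρ
  have hδρ : δ ≤ ρ := by rw [hδ]; nlinarith
  have hY0 : 0 ≤ Y := by positivity
  have hCyY : Cy ^ 2 ≤ Y := by
    have : 0 ≤ (2 * par.CN ^ 2 + 4 * CQ ^ 2 * ((1 + par.γA) / 2 * ρ) ^ 2
      + 4 * ((1 + par.γA) / 2 * ρ) ^ 2) / CA₁ ^ 2 := by positivity
    rw [hY]; nlinarith [sq_nonneg Cy]
  obtain ⟨R, hR0, hR⟩ := unregularized_bound (a₂ := CA₂) (q := CQ) hCA₁ hδ0 hρ hCs hY0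
  obtain ⟨k, hk0, hk⟩ := direction_bound (a₁ := CA₁) (a₂ := CA₂) (q := CQ) hδ0 hρ hCs hY0 hR0
    par.γμ_pos
  set k' := (CA₂ ^ 2 + 4 * CQ ^ 2 + 2) * (ρ + Cs) ^ 2 + 8 * CA₂ ^ 2 * (Cy ^ 2 + Cs ^ 2) with hk'
  have hk'0 : 0 ≤ k' := by positivity
  -- The constant dominates `k` for the direction, `2k + 2R` for the distance to the proximal
  -- estimates, and `k'` for the initial residuals.
  obtain ⟨κ, hκ0, hκ1, hκ⟩ := exists_acceptable (a₂ := CA₂) (q := CQ) (Cs := Cs) par hρ hCA₁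
    (K := 3 * k + 2 * R + k') (by positivity)
  refine ⟨κ, hκ0, hκ1, ?_⟩
  intro m n P v y₀ s σ d hn hy hP hI hσ0 hσ1 hN
  obtain ⟨hmem, hμ, hμρ, u, hux, huy, huμ, huρ, hu0, huz0, hpert⟩ := hI
  have hn1 := hP.pos
  have hρ2 : 0 < ρ ^ 2 := by positivity
  have hstart := interior_start hP hρ hδρ hCyY hy
  have hζ : s.zeta ⬝ᵥ s.zeta + s.lam ⬝ᵥ s.lam ≤ R * n ^ 2 := by
    obtain ⟨b, c, h1, h2, h3, h4⟩ := hpert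
    obtain ⟨e, he, hseg⟩ := exists_interior hP hCA₁ hρ hγ1 hy h3 h4
    rw [← hux, ← huy]
    obtain ⟨hs1, hs2⟩ := hseg (u.mu / mu0 (n := n) ρ y₀)
    rw [mu0_eq hn] at hs1 hs2 h1 h2
    refine hR m n P v e u (u.mu / ρ ^ 2) hP he (div_pos huμ hρ2) ((div_le_one hρ2).2 huρ)
      hu0 huz0 (h1.trans hs1) (h2.trans hs2) ?_
    rw [div_mul_cancel₀ _ hρ2.ne', dot_eq_mu hn]
  obtain ⟨⟨b, c, hA, hD, hpn, hsn⟩, hx, hz, hxz⟩ := hmem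
  obtain ⟨e, he, hseg⟩ := exists_interior hP hCA₁ hρ hγ1 hy hpn hsn
  obtain ⟨hs1, hs2⟩ := hseg (s.w.mu / mu0 (n := n) ρ y₀)
  have hmem' : s.w ∈ neighbourhood par P ρ y₀ s.w.mu s.zeta s.lam :=
    ⟨⟨b, c, hA, hD, hpn, hsn⟩, hx, hz, hxz⟩
  obtain ⟨hN1, hN2, hN3⟩ := hN
  have hN' : IsNewton P ρ y₀ s σ d := ⟨hN1, hN2, hN3⟩
  rw [hs1] at hA
  rw [hs2] at hD
  rw [mu0_eq hn] at hA hD hN1 hN2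
  rw [mul_div_assoc] at hN1 hN2
  have hσhalf := hσ1.trans par.σmax_le
  obtain ⟨g1, g2, g3, g4⟩ := hk m n P v e (startTriple n ρ y₀) s.w d (s.w.mu / ρ ^ 2) s.w.mu σ
    s.zeta s.lam hP he hstart (div_pos hμ hρ2) ((div_le_one hρ2).2 hμρ)
    (div_mul_cancel₀ _ hρ2.ne').symm (par.σmin_pos.le.trans hσ0) (by linarith) hζ hx hz
    (dot_eq_mu hn _) hxz hA hD hN2 hN1 hN3
  have hkK : k ≤ 3 * k + 2 * R + k' := by linarith
  have hmono : k * n ^ 4 * s.w.mu ≤ (3 * k + 2 * R + k') * n ^ 4 * s.w.mu := by gcongr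
  refine hκ m n P v y₀ s σ d hn hP hμ hmem' hσ0 hσ1 hN' (fun i => (g1 i).trans hmono)
    (g2.trans hmono) (g3.trans (by gcongr)) ?_ ?_ _ (by positivity) le_rfl
  · have e1 := sub_dot_self_le s.w.x s.zeta
    have e2 := sub_dot_self_le s.w.y s.lam
    have e3 : 0 ≤ (k + k') * (n : ℝ) ^ 2 := by positivity
    linarith
  · refine (initial_residual_bound hP hρ hy).trans ?_
    have e3 : 0 ≤ (3 * k + 2 * R) * (n : ℝ) ^ 2 := by positivity
    rw [← hk']; linarith

lemma mu_pos_of_pos (hn : 0 < n) {w : Triple m n} (hx : ∀ i, 0 < w.x i) (hz : ∀ i, 0 < w.z i) :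
    0 < w.mu := by
  have : Nonempty (Fin n) := ⟨⟨0, hn⟩⟩
  exact div_pos (Finset.sum_pos (fun i _ => mul_pos (hx i) (hz i)) Finset.univ_nonempty)
    (by exact_mod_cast hn)

/-- Maximality of the chosen step makes it at least `κ`, which gives the decrease. If the estimates
are refreshed, the proximal terms vanish at the new iterate and the test itself supplies the
perturbation. -/
lemma Invariant.step {par : Params} {P : Problem m n} {a₁ a₂ q Cs ρ : ℝ} {v : Triple m n}
    (hn : 0 < n) (hρ : 0 < ρ) (hP : Regular a₁ a₂ q Cs P v) (ha₁ : 0 < a₁) {y₀ : Fin m → ℝ}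
    {s s' : State m n} (hI : Invariant par P ρ y₀ s) {κ : ℝ}
    (hκ : ∀ σ d, par.σmin ≤ σ → σ ≤ par.σmax → IsNewton P ρ y₀ s σ d →
      κ ∈ acceptable par P ρ y₀ s d) (hstep : Step par P ρ y₀ s s') :
    Invariant par P ρ y₀ s' ∧ s'.w.mu ≤ (1 - 0.01 * κ) * s.w.mu := by
  obtain ⟨σ, d, α, hσ0, hσ1, hN, ⟨⟨hα0, hα1, hαμ, hαmem⟩, hαmax⟩, hw, htest, hntest⟩ := hstep
  have hκα : κ ≤ α := hαmax (hκ σ d hσ0 hσ1 hN)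
  rw [← hw] at hαμ hαmem
  obtain ⟨-, hx, hz, hxz⟩ := id hαmem
  have hμ' : 0 < s'.w.mu := mu_pos_of_pos hn hx hz
  have hdec : s'.w.mu ≤ (1 - 0.01 * κ) * s.w.mu :=
    hαμ.trans (mul_le_mul_of_nonneg_right (by linarith) hI.mu_pos.le)
  have hle : s'.w.mu ≤ ρ ^ 2 :=
    (hαμ.trans (mul_le_of_le_one_left hI.mu_pos.le (by linarith))).trans hI.mu_le
  refine ⟨?_, hdec⟩
  by_cases ht : updateTest par P ρ y₀ s'.w
  · obtain ⟨hζ, hlam⟩ := htest ht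
    have hpert : Perturbed par P ρ y₀ s'.w := perturbed_of_updateTest hP ha₁
      (div_pos hμ' (by rw [mu0_eq hn]; positivity)) ht
    refine ⟨?_, hμ', hle, s'.w, hζ.symm, hlam.symm, hμ', hle, hx, hz, hpert⟩
    rw [hζ, hlam]
    exact hpert.mem_neighbourhood hx hz hxz
  · obtain ⟨hζ, hlam⟩ := hntest ht
    refine ⟨by rw [hζ, hlam]; exact hαmem, hμ', hle, ?_⟩
    rw [hζ, hlam]
    exact hI.center

/-- Linear decrease at the rate `c` brings `μ` below `ε` after logarithmically many steps. -/
lemma pow_mul_le_of_log_le {c μ₀ ε : ℝ} (hc1 : c ≤ 1) (hμ₀ : 0 < μ₀) (hε : 0 < ε)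
    {k : ℕ} (hk : |Real.log μ₀| + Real.log (1 / ε) ≤ c * k) : (1 - c) ^ k * μ₀ ≤ ε := by
  have h1 : (1 - c) ^ k ≤ Real.exp (-(c * k)) := by
    have := pow_le_pow_left₀ (sub_nonneg.2 hc1) (Real.one_sub_le_exp_neg c) k
    rwa [← Real.exp_nat_mul, mul_neg, mul_comm (k : ℝ)] at this
  have h2 : Real.log (1 / ε) = -Real.log ε := by rw [one_div, Real.log_inv]
  rw [h2] at hk
  calc (1 - c) ^ k * μ₀ ≤ Real.exp (-(c * k)) * Real.exp (Real.log μ₀) := by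
        rw [Real.exp_log hμ₀]; exact mul_le_mul_of_nonneg_right h1 hμ₀.le
    _ = Real.exp (-(c * k) + Real.log μ₀) := (Real.exp_add _ _).symm
    _ ≤ Real.exp (Real.log ε) := Real.exp_le_exp.2 (by linarith [le_abs_self (Real.log μ₀)])
    _ = ε := Real.exp_log hε

end Convergence

end IPPMM

end

/-! ### The iteration count. -/

theorem theorem2 (par : IPPMM.Params) (ρ Cy Cstar CA₁ CA₂ CQ Cr C ω εbar : ℝ)
    (hρ : 0 < ρ) (hCstar : 0 ≤ Cstar)
    (hCA₁ : 0 < CA₁) (hCA₂ : 0 < CA₂) (hCQ : 0 < CQ) (hCr : 0 < Cr)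
    (hC : 0 < C) (hω : 0 < ω) (hεbar0 : 0 < εbar) (hεbar1 : εbar < 1) :
    ∃ M : ℝ, ∀ (m n : ℕ) (P : IPPMM.Problem m n) (y₀ : Fin m → ℝ) (ε : ℝ),
      0 < n → ‖y₀‖ ≤ Cy → 0 < ε → ε ≤ εbar →
      IPPMM.mu0 (n := n) ρ y₀ ≤ C / ε ^ ω →
      P.BoundedOptimum Cstar → P.BoundedData CA₁ CA₂ CQ Cr →
      ∃ K : ℕ, (K : ℝ) ≤ M * (n : ℝ) ^ 4 * |Real.log (1 / ε)| ∧
        ∀ (tol : ℝ) (N : ℕ) (s : ℕ → IPPMM.State m n),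
          IPPMM.IsRun par P ρ y₀ tol N s →
            (∀ k, K ≤ k → k ≤ N → (s k).w.mu ≤ ε) ∧
            -- no breakdown: the Newton system is uniquely solvable at every state that is reached,
            -- and acceptable step-lengths exist
            (∀ k ≤ N, ∀ σ, par.σmin ≤ σ → σ ≤ par.σmax →
              (∃! d, IPPMM.IsNewton P ρ y₀ (s k) σ d) ∧
              ∀ d, IPPMM.IsNewton P ρ y₀ (s k) σ d →
                (IPPMM.acceptable par P ρ y₀ (s k) d).Nonempty) := by
  obtain ⟨κ, hκ0, hκ1, hκ⟩ := IPPMM.exists_uniform_step (CA₂ := CA₂) (CQ := CQ) (Cy := Cy) par hρ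
    hCstar hCA₁
  set l := Real.log (1 / εbar) with hl
  have hl0 : 0 < l := Real.log_pos (by rw [one_div]; exact (one_lt_inv₀ hεbar0).2 hεbar1)
  set a := |Real.log (ρ ^ 2)| with ha
  -- Since `log(1/ε) ≥ l > 0`, the constant `a = |log μ₀|` and the 1 lost in rounding up are
  -- multiples of `log(1/ε)`; the factor 100 is the inverse of 0.01.
  refine ⟨(a / l + 1) * (100 / κ) + 1 / l, ?_⟩
  intro m n P y₀ ε hn hy hε hεb _ hopt hdata
  obtain ⟨v, hP⟩ := IPPMM.exists_regular hn hCA₁ hCA₂ hopt hdata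
  have hn4 : (1 : ℝ) ≤ (n : ℝ) ^ 4 := one_le_pow₀ hP.pos
  have hn40 : (0 : ℝ) < (n : ℝ) ^ 4 := by linarith
  have hll : l ≤ Real.log (1 / ε) :=
    Real.log_le_log (by positivity) (one_div_le_one_div_of_le hε hεb)
  set L := Real.log (1 / ε) with hL
  have hL0 : 0 < L := hl0.trans_le hll
  have ha0 : 0 ≤ a := abs_nonneg _
  set c := 0.01 * (κ / (n : ℝ) ^ 4) with hc
  have hc0 : 0 < c := by positivity
  have hc1 : c ≤ 1 := by
    have : κ / (n : ℝ) ^ 4 ≤ 1 := (div_le_one hn40).2 (hκ1.trans hn4)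
    rw [hc]; norm_num; linarith
  refine ⟨⌈(a + L) / c⌉₊, ?_, ?_⟩
  · rw [abs_of_pos hL0]
    have h1 : (a + L) / c = (a + L) * (100 / κ) * n ^ 4 := by
      rw [hc]; field_simp; norm_num
    have h2 : (⌈(a + L) / c⌉₊ : ℝ) ≤ (a + L) / c + 1 :=
      (Nat.ceil_lt_add_one (by positivity)).le
    have h3 : a ≤ a / l * L := by
      rw [div_mul_eq_mul_div, le_div_iff₀ hl0]
      exact mul_le_mul_of_nonneg_left hll ha0
    have h4 : 1 ≤ 1 / l * L := by
      rw [div_mul_eq_mul_div, le_div_iff₀ hl0]; linarith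
    have h5 : (a + L) * (100 / κ * n ^ 4) ≤ (a / l * L + L) * (100 / κ * n ^ 4) :=
      mul_le_mul_of_nonneg_right (by linarith) (by positivity)
    have h6 : 1 / l * L ≤ 1 / l * L * n ^ 4 := le_mul_of_one_le_right (by positivity) hn4
    linarith
  · intro tol N s hrun
    obtain ⟨h0, hsteps⟩ := hrun
    have hacc : ∀ k, IPPMM.Invariant par P ρ y₀ (s k) → ∀ σ d, par.σmin ≤ σ → σ ≤ par.σmax →
        IPPMM.IsNewton P ρ y₀ (s k) σ d →
        κ / (n : ℝ) ^ 4 ∈ IPPMM.acceptable par P ρ y₀ (s k) d :=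
      fun k hI σ d hσ0 hσ1 hN => hκ m n P v y₀ (s k) σ d hn hy hP hI hσ0 hσ1 hN
    have hmain : ∀ k ≤ N, IPPMM.Invariant par P ρ y₀ (s k) ∧
        (s k).w.mu ≤ (1 - c) ^ k * ρ ^ 2 := by
      intro k
      induction k with
      | zero =>
        intro _
        have hI := IPPMM.invariant_start par P hρ hn y₀
        rw [h0]
        exact ⟨hI, by simpa using hI.mu_le⟩
      | succ k ih =>
        intro hk
        obtain ⟨hI, hμ⟩ := ih (by omega)
        obtain ⟨hI', hμ'⟩ := hI.step hn hρ hP hCA₁ (hacc k hI) (hsteps k (by omega)).2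
        refine ⟨hI', hμ'.trans ?_⟩
        rw [show (1 - c) ^ (k + 1) * ρ ^ 2 = (1 - c) * ((1 - c) ^ k * ρ ^ 2) by ring]
        exact mul_le_mul_of_nonneg_left hμ (sub_nonneg.2 hc1)
    refine ⟨fun k hKk hkN => (hmain k hkN).2.trans ?_, fun k hkN σ hσ0 hσ1 => ?_⟩
    · refine IPPMM.pow_mul_le_of_log_le hc1 (by positivity) hε ?_
      rw [← ha, ← hL, mul_comm, ← div_le_iff₀ hc0]
      exact (Nat.le_ceil _).trans (by exact_mod_cast hKk)
    · have hI := (hmain k hkN).1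
      exact ⟨IPPMM.existsUnique_newton P ρ y₀ σ hI.mu_pos hI.mem.2.1 hI.mem.2.2.1,
        fun d hd => ⟨_, hacc k hI σ d hσ0 hσ1 hd⟩⟩
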